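/- Let $W$ be a finite reflection group acting essentially on a Euclidean space $V$, let $\mathcal{C}$ be a fundamental chamber of its Coxeter arrangement, let $S$ be the set of simple reflections (those in the walls of $\mathcal{C}$), let $(\alpha_s)_{s\in S}$ be simple roots (so that $\alpha_s \perp$ the hyperplane of $s$ and $\mathcal{C}=\{v : \langle\alpha_s,v\rangle\ge 0\ \forall s\}$), which form a basis of $V$, and let $(\omega_s)_{s \in S}$ be the fundamental weights, defined by $\langle\alpha_s,\omega_t\rangle=\delta_{s=t}\langle\alpha_s,\alpha_s\rangle/2$. Let $\Phi=\{w(\alpha_s) : w\in W, s\in S\}$, let $\Phi^+$ be the set of roots that are non-negative combinations of the simple roots, let $\ell$ be the length function of $(W,S)$ and $w_\circ$ the longest element. Let $Q=q_1\cdots q_m$ be a word on $S$ whose Demazure product is $w_\circ$. The subword complex $\mathcal{SC}(Q)$ is the simplicial complex of the sets of positions $I\subseteq[m]$ whose complement contains a reduced expression of $w_\circ$; its facets are its maximal faces. For a facet $I$ and $k\in[m]$, let $\sigma_{I,k}$ be the product, in this order, of the $q_z$ with $z<k$ and $z\notin I$; put $r(I,k)=\sigma_{I,k}(\alpha_{q_k})$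 and $w(I,k)=\sigma_{I,k}(\omega_{q_k})$. The root configuration of $I$ is the multiset $R(I)=\{\!\{r(I,i) : i\in I\}\!\}$, its brick vector is $B(I)=\sum_{k\in[m]}w(I,k)$, and the brick polytope is $B(Q)=\operatorname{conv}\{B(I) : I \text{ facet of } \mathcal{SC}(Q)\}$. Assume that $Q$ is realizing, i.e. that $R(I)$ is a linear basis of $V$ for every facet $I$. Then for every $w\in W$ there is a unique facet $\kappa(w)$ of $\mathcal{SC}(Q)$ such that $R(\kappa(w))\subseteq w(\Phi^+)$, and for every facet $I$ the normal cone of $B(I)$ in $B(Q)$, that is, the set of all $v\in V$ for which $x\mapsto\langle x,v\rangle$ is maximized over $B(Q)$ at $B(I)$, is $$\bigcup_{w\in W,\ \kappa(w)=I} w(\mathcal{C}).$$ Moreover, the Coxeter fan of $W$ (the chambers of the Coxeter arrangement together with all their non-empty faces) refines the normal fan of $B(Q)$ (the normal cones of the non-empty faces of $B(Q)$): every cone of the Coxeter fan is contained in a cone of the normal fan, and every cone of the normal fan is a union of cones of the Coxeter fan. -/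

import Mathlib

open scoped InnerProductSpace

noncomputable section

/-- The orthogonal reflection exchanging `β` and `-β` and fixing the hyperplane `β^⊥` pointwise. -/
def hyperplaneReflection {V : Type*} [NormedAddCommGroup V] [InnerProductSpace ℝ V]
    (β : V) : V ≃ₗᵢ[ℝ] V :=
  ((ℝ ∙ β)ᗮ).reflection

/-- A finite reflection group acting essentially on the Euclidean space `V`, with a chosen
fundamental chamber and simple roots `root i` of arbitrary lengths: the simple roots form a basis
of `V`, the group `W` generated by the simple reflections is finite, and the open cone
`{v | ∀ i, 0 < ⟪root i, v⟫}`, whose walls are the hyperplanes of the simple reflections,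
meets no reflecting hyperplane of `W`, that is, its closure is a chamber of `W`. -/
structure SimpleSystem (ι V : Type*) [Fintype ι] [NormedAddCommGroup V] [InnerProductSpace ℝ V]
    [FiniteDimensional ℝ V] where
  root : Module.Basis ι ℝ V
  finite_group :
    Finite (Subgroup.closure (Set.range fun i : ι => hyperplaneReflection (root i)))
  isChamber : ∀ β : V, β ≠ 0 →
    hyperplaneReflection β ∈
      Subgroup.closure (Set.range fun i : ι => hyperplaneReflection (root i)) →
    ∀ v : V, (∀ i, 0 < ⟪root i, v⟫_ℝ) → ⟪β, v⟫_ℝ ≠ 0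

namespace SimpleSystem

variable {ι V : Type*} [Fintype ι] [NormedAddCommGroup V] [InnerProductSpace ℝ V]
  [FiniteDimensional ℝ V] (S : SimpleSystem ι V)

/-- The finite Coxeter group `W`, generated by the simple reflections. -/
abbrev W : Subgroup (V ≃ₗᵢ[ℝ] V) :=
  Subgroup.closure (Set.range fun i : ι => hyperplaneReflection (S.root i))

instance : Finite S.W := S.finite_group

/-- The simple reflection `s_i`, as an element of `W`. -/
def simple (i : ι) : S.W :=
  ⟨hyperplaneReflection (S.root i), Subgroup.subset_closure ⟨i, rfl⟩⟩

/-- The action of `w ∈ W` on `V`. -/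
def act (w : S.W) (v : V) : V := (w : V ≃ₗᵢ[ℝ] V) v

/-- The root system `Φ`: the orbit of the simple roots. -/
def roots : Set V := {β | ∃ (w : S.W) (i : ι), β = S.act w (S.root i)}

/-- The positive roots: the roots that are non-negative combinations of the simple roots. -/
def posRoots : Set V := {β | β ∈ S.roots ∧ ∀ i, 0 ≤ S.root.repr β i}

open scoped Classical in
/-- The fundamental weights: the dual basis of `2 α_i / ⟪α_i, α_i⟫`. -/
def weight (i : ι) : V :=
  (⟪S.root i, S.root i⟫_ℝ / 2) •
    LinearMap.BilinForm.dualBasis (innerₗ V)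
      ⟨fun x hx => inner_self_eq_zero.mp (hx x), fun x hx => inner_self_eq_zero.mp (hx x)⟩
      S.root i

open scoped Classical in
theorem inner_root_weight (s t : ι) :
    ⟪S.root s, S.weight t⟫_ℝ = if s = t then ⟪S.root s, S.root s⟫_ℝ / 2 else 0 := by
  have h := LinearMap.BilinForm.apply_dualBasis_left (B := innerₗ V)
    ⟨fun x hx => inner_self_eq_zero.mp (hx x), fun x hx => inner_self_eq_zero.mp (hx x)⟩
    S.root t s
  rw [innerₗ_apply_apply, real_inner_comm] at h
  rw [weight, inner_smul_right, h]
  split_ifs with hst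
  · subst hst; simp
  · simp

/-- The fundamental chamber. -/
def fundamentalChamber : Set V := {v | ∀ i, 0 ≤ ⟪S.root i, v⟫_ℝ}

/-- The complement of the Coxeter arrangement, the union of all reflecting hyperplanes of `W`. -/
def arrangementComplement : Set V :=
  {v | ∀ β : V, β ≠ 0 → hyperplaneReflection β ∈ S.W → ⟪β, v⟫_ℝ ≠ 0}

/-- The chambers: closures of the connected components of the complement of the arrangement. -/
def chambers : Set (Set V) :=
  {D | ∃ x ∈ S.arrangementComplement,
    D = closure (connectedComponentIn S.arrangementComplement x)}

/-- The Coxeter fan: the chambers together with all their (non-empty) faces. -/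
def coxeterFan : Set (Set V) :=
  {F | ∃ D ∈ S.chambers, F.Nonempty ∧ IsExposed ℝ D F}

/-- The element of `W` expressed by a word. -/
def wordProd (L : List ι) : S.W := (L.map S.simple).prod

/-- The length of `w`: the smallest length of a word in the simple reflections expressing `w`. -/
def length (w : S.W) : ℕ := sInf {n | ∃ L : List ι, L.length = n ∧ S.wordProd L = w}

theorem exists_longest : ∃ w : S.W, ∀ u : S.W, S.length u ≤ S.length w :=
  Finite.exists_max S.length

/-- The longest element of `W`. -/
def longest : S.W := S.exists_longest.choose

/-- The Demazure product of a word. -/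
def demazure (Q : List ι) : S.W :=
  Q.foldl (fun w i =>
    if S.length (w * S.simple i) = S.length w + 1 then w * S.simple i else w) 1

/-- The product, from left to right, of the letters of `Q` at the positions in `A`. -/
def subwordProd (Q : List ι) (A : Finset (Fin Q.length)) : S.W :=
  S.wordProd (((List.finRange Q.length).filter (· ∈ A)).map Q.get)

/-- The letters of `Q` at the positions in `A` form a reduced expression of `ρ`. -/
def IsReducedExpr (Q : List ι) (ρ : S.W) (A : Finset (Fin Q.length)) : Prop :=
  S.subwordProd Q A = ρ ∧ A.card = S.length ρ

/-- The faces of the subword complex of `Q` and `ρ`: the sets of positions whose complement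
contains a reduced expression of `ρ`. -/
def IsFace (Q : List ι) (ρ : S.W) (I : Finset (Fin Q.length)) : Prop :=
  ∃ A : Finset (Fin Q.length), A ⊆ Iᶜ ∧ S.IsReducedExpr Q ρ A

/-- The facets (maximal faces) of the spherical subword complex `SC(Q) = SC(Q, w₀)`. -/
def IsFacet (Q : List ι) (I : Finset (Fin Q.length)) : Prop :=
  Maximal (S.IsFace Q S.longest) I

/-- The product `σ_I^{[1,k-1]}` of the letters of `Q` at the positions before `k` not in `I`. -/
def prefixProd (Q : List ι) (I : Finset (Fin Q.length)) (k : Fin Q.length) : S.W :=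
  S.subwordProd Q (Finset.univ.filter fun z => z < k ∧ z ∉ I)

/-- The root function `r(I, k)`. -/
def rootFn (Q : List ι) (I : Finset (Fin Q.length)) (k : Fin Q.length) : V :=
  S.act (S.prefixProd Q I k) (S.root (Q.get k))

/-- The weight function `w(I, k)`. -/
def weightFn (Q : List ι) (I : Finset (Fin Q.length)) (k : Fin Q.length) : V :=
  S.act (S.prefixProd Q I k) (S.weight (Q.get k))

/-- The word `Q` is realizing: the root configuration `{{r(I, i) | i ∈ I}}` of every facet `I`
is a linear basis of `V`. -/
def IsRealizing (Q : List ι) : Prop :=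
  ∀ I : Finset (Fin Q.length), S.IsFacet Q I →
    LinearIndependent ℝ (fun i : I => S.rootFn Q I i) ∧
      Submodule.span ℝ (Set.range fun i : I => S.rootFn Q I i) = ⊤

/-- The root configuration of `I` is contained in `w(Φ⁺)`. -/
def RootConfigSubset (Q : List ι) (I : Finset (Fin Q.length)) (w : S.W) : Prop :=
  ∀ i ∈ I, S.rootFn Q I i ∈ S.act w '' S.posRoots

/-- The brick vector `B(I)`. -/
def brickVector (Q : List ι) (I : Finset (Fin Q.length)) : V :=
  ∑ k : Fin Q.length, S.weightFn Q I k

/-- The brick polytope `B(Q)`. -/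
def brickPolytope (Q : List ι) : Set V :=
  convexHull ℝ {x | ∃ I, S.IsFacet Q I ∧ x = S.brickVector Q I}

end SimpleSystem

/-- The normal cone of a face `F` of a polytope `P`: all `v` such that `x ↦ ⟪x, v⟫` on `P`
is maximized by all points of `F`. -/
def normalCone {V : Type*} [NormedAddCommGroup V] [InnerProductSpace ℝ V] (P F : Set V) : Set V :=
  {v | ∀ x ∈ F, ∀ y ∈ P, ⟪y, v⟫_ℝ ≤ ⟪x, v⟫_ℝ}

/-- The normal fan of a polytope: the normal cones of its non-empty faces. -/
def normalFan {V : Type*} [NormedAddCommGroup V] [InnerProductSpace ℝ V] (P : Set V) :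
    Set (Set V) :=
  {K | ∃ F : Set V, F.Nonempty ∧ IsExposed ℝ P F ∧ K = normalCone P F}

/-- The fan `𝓕` refines the fan `𝓖`: every cone of `𝓕` is contained in a cone of `𝓖`, and
every cone of `𝓖` is a union of cones of `𝓕`. -/
def FanRefines {V : Type*} (𝓕 𝓖 : Set (Set V)) : Prop :=
  (∀ K ∈ 𝓕, ∃ L ∈ 𝓖, K ⊆ L) ∧ ∀ L ∈ 𝓖, ∃ T ⊆ 𝓕, L = ⋃₀ T

end

noncomputable section

namespace SimpleSystem

variable {ι V : Type*} [Fintype ι] [NormedAddCommGroup V] [InnerProductSpace ℝ V]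
  [FiniteDimensional ℝ V] (S : SimpleSystem ι V)

/-! ### Reflections, roots and the fundamental chamber. -/

section

/-! Write `ρ` for `weightSum`, a point inside the fundamental chamber `C`. Reading the letters
outside a facet `I` gives a gallery from `C` to `w₀ C` that crosses every root hyperplane exactly
once. So each `i ∈ I` has a unique partner `j ∉ I` with the same reflection, and exchanging them
gives a facet with brick vector `B(I) - c • r(I, i)`, `c > 0` (`IsFacet.brickVector_flip`).

Existence of `κ(w)`: a facet whose brick vector is maximal in a direction inside `w(C)` cannot be
improved by a flip, so its roots are positive there (`IsFacet.rootConfigSubset_of_max`).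

Uniqueness: for `w = 1` the facet can be reconstructed letter by letter from the right. Passing from
`w s_i` to an adjacent `w` changes the sign of roots on one line only; linear independence leaves at
most one position of `I` on that line, and flipping it, if present, is an involution carrying facets
for `w s_i` to facets for `w` (`IsRealizing.crossFlip_spec`).

Normal cones: by uniqueness, every maximizer in a direction inside `w(C)` is `κ(w)`, so `w(C)` lies
in the cone of `κ(w)`. Conversely, if `v` is in the cone of `I`, independence gives `u` positive on
`R(I)`, and `v + ε u + ε² ρ` lies inside some `w(C)` that contains `v` and has `κ(w) = I`. For the
refinement, a point of a normal cone brings with it the whole face of the chamber in whose relative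
interior it lies. -/

theorem _root_.hyperplaneReflection_apply {E : Type*} [NormedAddCommGroup E]
    [InnerProductSpace ℝ E] (β v : E) :
    hyperplaneReflection β v = v - (2 * ⟪β, v⟫_ℝ / ⟪β, β⟫_ℝ) • β := by
  rw [hyperplaneReflection, Submodule.reflection_orthogonal_apply,
    Submodule.reflection_singleton_apply, neg_sub, real_inner_self_eq_norm_sq]
  congr 1
  rw [two_smul, ← add_smul]
  congr 1
  simp
  ring

@[simp] theorem act_one (v : V) : S.act 1 v = v := rfl

theorem act_mul (u w : S.W) (v : V) : S.act (u * w) v = S.act u (S.act w v) := rfl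

@[simp] theorem act_inv_act (w : S.W) (v : V) : S.act w⁻¹ (S.act w v) = v := by
  rw [← act_mul, inv_mul_cancel, act_one]

@[simp] theorem act_act_inv (w : S.W) (v : V) : S.act w (S.act w⁻¹ v) = v := by
  rw [← act_mul, mul_inv_cancel, act_one]

@[simp] theorem act_neg (w : S.W) (v : V) : S.act w (-v) = -S.act w v :=
  map_neg (w : V ≃ₗᵢ[ℝ] V) v

theorem act_sub (w : S.W) (x y : V) : S.act w (x - y) = S.act w x - S.act w y :=
  map_sub (w : V ≃ₗᵢ[ℝ] V) x y

theorem act_smul (w : S.W) (c : ℝ) (x : V) : S.act w (c • x) = c • S.act w x :=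
  map_smul (w : V ≃ₗᵢ[ℝ] V) c x

@[simp] theorem inner_act_act (w : S.W) (x y : V) : ⟪S.act w x, S.act w y⟫_ℝ = ⟪x, y⟫_ℝ :=
  (w : V ≃ₗᵢ[ℝ] V).inner_map_map x y

theorem inner_act_left (w : S.W) (x y : V) : ⟪S.act w x, y⟫_ℝ = ⟪x, S.act w⁻¹ y⟫_ℝ := by
  rw [← S.inner_act_act w⁻¹, act_inv_act]

theorem ext_act {u w : S.W} (h : ∀ v, S.act u v = S.act w v) : u = w :=
  Subtype.ext (LinearIsometryEquiv.ext h)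

theorem inner_root_self_pos (i : ι) : 0 < ⟪S.root i, S.root i⟫_ℝ :=
  real_inner_self_pos.mpr (S.root.ne_zero i)

theorem act_simple (i : ι) (v : V) :
    S.act (S.simple i) v =
      v - (2 * ⟪S.root i, v⟫_ℝ / ⟪S.root i, S.root i⟫_ℝ) • S.root i :=
  hyperplaneReflection_apply _ _

theorem simple_mul_self (i : ι) : S.simple i * S.simple i = 1 :=
  Subtype.ext (Submodule.reflection_mul_reflection _)

@[simp] theorem simple_inv (i : ι) : (S.simple i)⁻¹ = S.simple i :=
  inv_eq_of_mul_eq_one_left (S.simple_mul_self i)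

theorem act_simple_root (i : ι) : S.act (S.simple i) (S.root i) = -S.root i := by
  rw [act_simple, mul_div_assoc, div_self (S.inner_root_self_pos i).ne', mul_one, two_smul]
  abel

/-- The reflection `w s_i w⁻¹`, whose root is `w (α_i)`. -/
def conjSimple (w : S.W) (i : ι) : S.W := w * S.simple i * w⁻¹

theorem conjSimple_mul_self (w : S.W) (i : ι) : S.conjSimple w i * S.conjSimple w i = 1 := by
  have h := S.simple_mul_self i
  calc _ = w * (S.simple i * S.simple i) * w⁻¹ := by rw [conjSimple]; group
    _ = 1 := by rw [h]; group

theorem act_conjSimple (w : S.W) (i : ι) (v : V) :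
    S.act (S.conjSimple w i) v =
      v - (2 * ⟪S.act w (S.root i), v⟫_ℝ / ⟪S.root i, S.root i⟫_ℝ) • S.act w (S.root i) := by
  rw [conjSimple, act_mul, act_mul, act_simple, act_sub, act_act_inv, act_smul, inner_act_left]

theorem act_conjSimple_root (w : S.W) (i : ι) :
    S.act (S.conjSimple w i) (S.act w (S.root i)) = -S.act w (S.root i) := by
  rw [conjSimple, act_mul, act_inv_act, act_mul, act_simple_root, act_neg]

theorem act_root_ne_zero (w : S.W) (i : ι) : S.act w (S.root i) ≠ 0 := fun h => by
  have := S.inner_root_self_pos i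
  rw [← S.inner_act_act w, h, inner_zero_left] at this
  exact this.false

/-- Simple roots have arbitrary lengths, so `Φ` may contain several positive multiples of one root.
Hyperplanes are therefore identified by their reflections. -/
theorem conjSimple_eq_iff (u w : S.W) (i j : ι) :
    S.conjSimple u i = S.conjSimple w j ↔
      ∃ c : ℝ, c ≠ 0 ∧ S.act u (S.root i) = c • S.act w (S.root j) := by
  constructor
  · intro h
    have h1 := S.act_conjSimple_root u i
    rw [h, act_conjSimple] at h1
    set k := 2 * ⟪S.act w (S.root j), S.act u (S.root i)⟫_ℝ / ⟪S.root j, S.root j⟫_ℝ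
    have h2 : S.act u (S.root i) = (k / 2) • S.act w (S.root j) := by
      have h3 : (2 : ℝ) • S.act u (S.root i) = k • S.act w (S.root j) := by
        rw [two_smul]
        calc _ = S.act u (S.root i) - (k • S.act w (S.root j) + -S.act u (S.root i)) +
              k • S.act w (S.root j) := by abel
          _ = _ := by rw [← h1]; abel
      rw [div_eq_inv_mul, mul_smul, ← h3, smul_smul]
      norm_num
    refine ⟨k / 2, fun h0 => S.act_root_ne_zero u i ?_, h2⟩
    rw [h2, h0, zero_smul]
  · rintro ⟨c, hc, h⟩
    refine S.ext_act fun v => ?_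
    have hi := (S.inner_root_self_pos i).ne'
    have hj := (S.inner_root_self_pos j).ne'
    have hh : ⟪S.root i, S.root i⟫_ℝ = c * (c * ⟪S.root j, S.root j⟫_ℝ) := by
      rw [← S.inner_act_act u, h, inner_smul_left, inner_smul_right, inner_act_act]
      simp
    rw [act_conjSimple, act_conjSimple, hh, h, inner_smul_left, smul_smul]
    congr 2
    simp
    field_simp

theorem act_root_mem_roots (w : S.W) (i : ι) : S.act w (S.root i) ∈ S.roots := ⟨w, i, rfl⟩

theorem act_mem_roots (w : S.W) {β : V} (h : β ∈ S.roots) : S.act w β ∈ S.roots := by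
  obtain ⟨u, i, rfl⟩ := h
  exact ⟨w * u, i, rfl⟩

theorem neg_mem_roots {β : V} (h : β ∈ S.roots) : -β ∈ S.roots := by
  obtain ⟨u, i, rfl⟩ := h
  exact ⟨u * S.simple i, i, by rw [act_mul, act_simple_root, act_neg]⟩

theorem hyperplaneReflection_act_root (w : S.W) (i : ι) :
    hyperplaneReflection (S.act w (S.root i)) = S.conjSimple w i := by
  ext v
  rw [hyperplaneReflection_apply, inner_act_act]
  exact (S.act_conjSimple w i v).symm

theorem ne_zero_of_mem_roots {β : V} (h : β ∈ S.roots) : β ≠ 0 := by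
  obtain ⟨u, i, rfl⟩ := h
  exact S.act_root_ne_zero u i

theorem hyperplaneReflection_mem {β : V} (h : β ∈ S.roots) : hyperplaneReflection β ∈ S.W := by
  obtain ⟨u, i, rfl⟩ := h
  rw [hyperplaneReflection_act_root]
  exact (S.conjSimple u i).2

/-- The interior of the fundamental chamber. -/
def openChamber : Set V := {v | ∀ i, 0 < ⟪S.root i, v⟫_ℝ}

theorem inner_ne_zero {β v : V} (h : β ∈ S.roots) (hv : v ∈ S.openChamber) : ⟪β, v⟫_ℝ ≠ 0 :=
  S.isChamber β (S.ne_zero_of_mem_roots h) (S.hyperplaneReflection_mem h) v hv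

/-- The sum of the fundamental weights. -/
def weightSum : V := ∑ i, S.weight i

theorem inner_root_weight_nonneg (i j : ι) : 0 ≤ ⟪S.root i, S.weight j⟫_ℝ := by
  rw [inner_root_weight]
  split_ifs
  · exact (half_pos (S.inner_root_self_pos i)).le
  · exact le_rfl

theorem weightSum_mem : S.weightSum ∈ S.openChamber := by
  classical
  intro i
  rw [weightSum, inner_sum]
  simp only [inner_root_weight]
  rw [Finset.sum_ite_eq]
  simpa using S.inner_root_self_pos i

theorem inner_eq_sum (β v : V) : ⟪β, v⟫_ℝ = ∑ i, S.root.repr β i * ⟪S.root i, v⟫_ℝ := by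
  conv_lhs => rw [← S.root.sum_repr β]
  rw [sum_inner]
  simp [inner_smul_left]

theorem inner_weight (β : V) (j : ι) :
    ⟪β, S.weight j⟫_ℝ = S.root.repr β j * (⟪S.root j, S.root j⟫_ℝ / 2) := by
  classical
  rw [S.inner_eq_sum]
  simp [inner_root_weight]

/-- If the coefficient at `j` were negative, moving from `v` along the weight of `j` would stay in
the open chamber and reach the hyperplane of `β`, against `isChamber`. -/
theorem repr_nonneg {β v : V} (h : β ∈ S.roots) (hv : v ∈ S.openChamber)
    (hpos : 0 < ⟪β, v⟫_ℝ) (j : ι) : 0 ≤ S.root.repr β j := by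
  by_contra! hj
  have hneg : ⟪β, S.weight j⟫_ℝ < 0 := by
    rw [inner_weight]
    exact mul_neg_of_neg_of_pos hj (half_pos (S.inner_root_self_pos j))
  set c := -⟪β, v⟫_ℝ / ⟪β, S.weight j⟫_ℝ with hc
  have hc0 : 0 ≤ c := div_nonneg_of_nonpos (by linarith) hneg.le
  refine S.inner_ne_zero h (v := v + c • S.weight j) (fun i => ?_) ?_
  · rw [inner_add_right, inner_smul_right]
    exact add_pos_of_pos_of_nonneg (hv i) (mul_nonneg hc0 (S.inner_root_weight_nonneg i j))
  · rw [inner_add_right, inner_smul_right, hc, div_mul_cancel₀ _ hneg.ne]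
    ring

theorem inner_nonneg_of_repr_nonneg {β v : V} (h : ∀ j, 0 ≤ S.root.repr β j)
    (hv : v ∈ S.fundamentalChamber) : 0 ≤ ⟪β, v⟫_ℝ := by
  rw [S.inner_eq_sum]
  exact Finset.sum_nonneg fun i _ => mul_nonneg (h i) (hv i)

theorem openChamber_subset : S.openChamber ⊆ S.fundamentalChamber := fun _ h i => (h i).le

theorem mem_posRoots_iff {β v : V} (hv : v ∈ S.openChamber) :
    β ∈ S.posRoots ↔ β ∈ S.roots ∧ 0 < ⟪β, v⟫_ℝ :=
  ⟨fun h => ⟨h.1, lt_of_le_of_ne (S.inner_nonneg_of_repr_nonneg h.2 (S.openChamber_subset hv))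
    (S.inner_ne_zero h.1 hv).symm⟩, fun h => ⟨h.1, S.repr_nonneg h.1 hv h.2⟩⟩

theorem mem_act_posRoots_iff {β v : V} (hv : v ∈ S.openChamber) (w : S.W) :
    β ∈ S.act w '' S.posRoots ↔ β ∈ S.roots ∧ 0 < ⟪β, S.act w v⟫_ℝ := by
  constructor
  · rintro ⟨γ, hγ, rfl⟩
    rw [S.mem_posRoots_iff hv] at hγ
    exact ⟨S.act_mem_roots w hγ.1, by rw [inner_act_act]; exact hγ.2⟩
  · rintro ⟨h1, h2⟩
    refine ⟨S.act w⁻¹ β, (S.mem_posRoots_iff hv).2 ⟨S.act_mem_roots _ h1, ?_⟩, by simp⟩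
    rwa [inner_act_left, inv_inv]

theorem inner_act_ne_zero {β v : V} (h : β ∈ S.roots) (hv : v ∈ S.openChamber) (w : S.W) :
    ⟪β, S.act w v⟫_ℝ ≠ 0 := by
  rw [real_inner_comm, inner_act_left, real_inner_comm]
  exact S.inner_ne_zero (S.act_mem_roots _ h) hv

/-- Two chambers that share the wall of `w (α_i)` are separated by no other hyperplane. -/
theorem exists_pos_smul_of_crossing {γ : V} (h : γ ∈ S.roots) (w : S.W) (i : ι)
    (h1 : 0 < ⟪γ, S.act w S.weightSum⟫_ℝ)
    (h2 : ⟪γ, S.act (w * S.simple i) S.weightSum⟫_ℝ < 0) :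
    ∃ c : ℝ, 0 < c ∧ γ = c • S.act w (S.root i) := by
  set δ := S.act w⁻¹ γ with hδ
  have hδr : δ ∈ S.roots := S.act_mem_roots _ h
  have hγ : γ = S.act w δ := by simp [hδ]
  have h1' : 0 < ⟪δ, S.weightSum⟫_ℝ := by rwa [hγ, inner_act_act] at h1
  have h2' : 0 < ⟪-S.act (S.simple i) δ, S.weightSum⟫_ℝ := by
    rw [hγ, act_mul, inner_act_act] at h2
    rw [inner_neg_left, inner_act_left, simple_inv]
    linarith
  have hp := S.repr_nonneg hδr S.weightSum_mem h1'
  have hn := S.repr_nonneg (S.neg_mem_roots (S.act_mem_roots _ hδr)) S.weightSum_mem h2'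
  -- The simple reflection changes only the coefficient at `i`; elsewhere `δ` and `-s_i δ` have
  -- opposite coefficients, both non-negative.
  have hz : ∀ j, j ≠ i → S.root.repr δ j = 0 := by
    intro j hj
    have := hn j
    rw [act_simple] at this
    simp [hj.symm] at this
    exact le_antisymm this (hp j)
  have hδe : δ = S.root.repr δ i • S.root i := by
    conv_lhs => rw [← S.root.sum_repr δ]
    refine Finset.sum_eq_single i (fun j _ hj => ?_) (by simp)
    rw [hz j hj, zero_smul]
  refine ⟨S.root.repr δ i, lt_of_le_of_ne (hp i) fun h0 => S.ne_zero_of_mem_roots hδr ?_, ?_⟩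
  · rw [hδe, ← h0, zero_smul]
  · rw [← act_smul, ← hδe, hγ]

theorem inner_weight_nonneg {γ : V} (h : γ ∈ S.roots) (w : S.W) (i : ι)
    (h1 : 0 < ⟪γ, S.act w S.weightSum⟫_ℝ) : 0 ≤ ⟪γ, S.act w (S.weight i)⟫_ℝ := by
  have h2 : 0 < ⟪S.act w⁻¹ γ, S.weightSum⟫_ℝ := by rwa [inner_act_left, inv_inv]
  rw [← S.inner_act_act w⁻¹, act_inv_act]
  refine S.inner_nonneg_of_repr_nonneg (S.repr_nonneg (S.act_mem_roots _ h) S.weightSum_mem h2) ?_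
  exact fun j => S.inner_root_weight_nonneg j i

theorem inner_weight_pos {γ : V} (w : S.W) (i : ι) {c : ℝ} (hγ : γ = c • S.act w (S.root i))
    (h1 : 0 < ⟪γ, S.act w S.weightSum⟫_ℝ) : 0 < ⟪γ, S.act w (S.weight i)⟫_ℝ := by
  have h2 := S.weightSum_mem i
  rw [hγ, inner_smul_left, inner_act_act] at h1 ⊢
  have hc : 0 < c := by
    simpa using (pos_iff_pos_of_mul_pos h1).2 h2
  rw [inner_root_weight, if_pos rfl]
  exact mul_pos (by simpa using hc) (half_pos (S.inner_root_self_pos i))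

end

/-! ### Subwords, their prefix products and their root reflections. -/

section

theorem conjSimple_mul (u w : S.W) (i : ι) :
    S.conjSimple (u * w) i = u * S.conjSimple w i * u⁻¹ := by
  simp only [conjSimple]
  group

theorem conjSimple_conjSimple_mul (w : S.W) (i : ι) (u : S.W) (j : ι)
    (h : S.conjSimple w i = S.conjSimple u j) :
    S.conjSimple (S.conjSimple u j * w) i = S.conjSimple u j := by
  rw [conjSimple_mul, h]
  group

/-- A change of sign in either direction would be a crossing, by the root or by its opposite, and
would force the two reflections to agree. -/
theorem pos_iff_of_conjSimple_ne {w u : S.W} {i j : ι}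
    (h : S.conjSimple w j ≠ S.conjSimple u i) :
    0 < ⟪S.act u (S.root i), S.act w S.weightSum⟫_ℝ ↔
      0 < ⟪S.act u (S.root i), S.act (w * S.simple j) S.weightSum⟫_ℝ := by
  have hr := S.act_root_mem_roots u i
  have hn := S.inner_act_ne_zero hr S.weightSum_mem
  constructor
  · intro h1
    by_contra h2
    have h3 := lt_of_le_of_ne (not_lt.1 h2) (hn _)
    obtain ⟨c, hc, hc'⟩ := S.exists_pos_smul_of_crossing hr w j h1 h3
    exact h ((S.conjSimple_eq_iff u w i j).2 ⟨c, hc.ne', hc'⟩).symm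
  · intro h1
    by_contra h2
    have h3 := lt_of_le_of_ne (not_lt.1 h2) (hn _)
    obtain ⟨c, hc, hc'⟩ := S.exists_pos_smul_of_crossing (S.neg_mem_roots hr) w j
      (by rw [inner_neg_left]; linarith) (by rw [inner_neg_left]; linarith)
    exact h ((S.conjSimple_eq_iff u w i j).2
      ⟨-c, neg_ne_zero.2 hc.ne', by rw [neg_smul, ← hc', neg_neg]⟩).symm

variable (Q : List ι)

/-- The product of the letters of `Q` outside `I` among the first `k` positions. -/
def partialProd (I : Finset (Fin Q.length)) (k : ℕ) : S.W :=
  S.subwordProd Q (Finset.univ.filter fun z => (z : ℕ) < k ∧ z ∉ I)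

/-- The reflection in the root `r(I, k)`. -/
def rootRefl (I : Finset (Fin Q.length)) (k : Fin Q.length) : S.W :=
  S.conjSimple (S.partialProd Q I k) (Q.get k)

variable {Q} {I : Finset (Fin Q.length)}

theorem rootFn_eq (k : Fin Q.length) :
    S.rootFn Q I k = S.act (S.partialProd Q I k) (S.root (Q.get k)) := rfl

theorem rootFn_mem_roots (k : Fin Q.length) : S.rootFn Q I k ∈ S.roots :=
  S.act_root_mem_roots _ _

theorem partialProd_zero : S.partialProd Q I 0 = 1 := by
  simp [partialProd, subwordProd, wordProd]

theorem partialProd_length : S.partialProd Q I Q.length = S.subwordProd Q Iᶜ := by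
  unfold partialProd
  congr 1
  ext z
  simp

theorem partialProd_congr {J : Finset (Fin Q.length)} {k : ℕ}
    (h : ∀ z : Fin Q.length, (z : ℕ) < k → (z ∈ I ↔ z ∈ J)) :
    S.partialProd Q I k = S.partialProd Q J k := by
  unfold partialProd
  congr 1
  ext z
  simp only [Finset.mem_filter, Finset.mem_univ, true_and]
  exact and_congr_right fun hz => not_congr (h z hz)

theorem partialProd_succ_of_mem {k : Fin Q.length} (h : k ∈ I) :
    S.partialProd Q I (k + 1) = S.partialProd Q I k := by
  unfold partialProd
  congr 1
  ext z
  simp only [Finset.mem_filter, Finset.mem_univ, true_and]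
  refine and_congr_left fun hz => ?_
  have : (z : ℕ) ≠ k := fun e => hz (Fin.ext e ▸ h)
  omega

theorem partialProd_succ_of_notMem {k : Fin Q.length} (h : k ∉ I) :
    S.partialProd Q I (k + 1) = S.partialProd Q I k * S.simple (Q.get k) := by
  have key : (List.finRange Q.length).filter
        (· ∈ Finset.univ.filter fun z : Fin Q.length => (z : ℕ) < k + 1 ∧ z ∉ I) =
      (List.finRange Q.length).filter
        (· ∈ Finset.univ.filter fun z : Fin Q.length => (z : ℕ) < k ∧ z ∉ I) ++ [k] := by
    refine List.SortedLT.eq_of_mem_iff ?_ ?_ ?_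
    · exact ((List.sortedLT_finRange _).pairwise.filter _).sortedLT
    · refine List.Pairwise.sortedLT (List.pairwise_append.2 ⟨?_, List.pairwise_singleton _ _, ?_⟩)
      · exact (List.sortedLT_finRange _).pairwise.filter _
      · intro a ha b hb
        simp at ha hb
        subst hb
        exact ha.1
    · intro a
      simp only [List.mem_filter, List.mem_append, List.mem_finRange, Finset.mem_filter,
        Finset.mem_univ, true_and, decide_eq_true_eq, List.mem_singleton]
      constructor
      · rintro ⟨h1, h2⟩
        by_cases e : a = k
        · exact Or.inr e
        · have : (a : ℕ) ≠ k := fun e' => e (Fin.ext e')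
          exact Or.inl ⟨by omega, h2⟩
      · rintro (⟨h1, h2⟩ | rfl)
        · exact ⟨by omega, h2⟩
        · exact ⟨by omega, h⟩
  unfold partialProd subwordProd
  rw [key]
  simp [wordProd]

theorem partialProd_empty {k : ℕ} (hk : k ≤ Q.length) :
    S.partialProd Q ∅ k = S.wordProd (Q.take k) := by
  induction k with
  | zero => simp [partialProd_zero, wordProd]
  | succ k ih =>
    have := S.partialProd_succ_of_notMem (Q := Q) (I := ∅) (k := ⟨k, hk⟩) (by simp)
    rw [this, ih (by omega), List.take_succ_eq_append_getElem hk]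
    simp only [wordProd, List.map_append, List.prod_append]
    simp

theorem partialProd_symmDiff_of_le {i : Fin Q.length} {k : ℕ} (h : k ≤ i) :
    S.partialProd Q (symmDiff I {i}) k = S.partialProd Q I k := by
  refine S.partialProd_congr fun z hz => ?_
  have : z ≠ i := fun e => by subst e; omega
  simp [Finset.mem_symmDiff, this]

/-- Inserting or deleting a letter `s` after a prefix `p` multiplies all later products on the left
by `p s p⁻¹`. -/
theorem partialProd_symmDiff_of_lt {i : Fin Q.length} {k : ℕ} (h : i < k) (hk : k ≤ Q.length) :
    S.partialProd Q (symmDiff I {i}) k = S.rootRefl Q I i * S.partialProd Q I k := by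
  induction k, h using Nat.le_induction with
  | base =>
    by_cases hi : i ∈ I
    · rw [S.partialProd_succ_of_mem hi, S.partialProd_succ_of_notMem
        (by simp [Finset.mem_symmDiff, hi]), S.partialProd_symmDiff_of_le le_rfl, rootRefl,
        conjSimple]
      group
    · rw [S.partialProd_succ_of_notMem hi, S.partialProd_succ_of_mem
        (by simp [Finset.mem_symmDiff, hi]), S.partialProd_symmDiff_of_le le_rfl, rootRefl,
        conjSimple]
      have := S.simple_mul_self (Q.get i)
      calc _ = S.partialProd Q I i * (S.simple (Q.get i) * S.simple (Q.get i)) := by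
            rw [this, mul_one]
        _ = _ := by group
  | succ k hik ih =>
    specialize ih (by omega)
    have hne : (⟨k, hk⟩ : Fin Q.length) ≠ i := fun e => by
      have := congrArg Fin.val e
      simp at this hik
      omega
    have hmem : (⟨k, hk⟩ : Fin Q.length) ∈ symmDiff I {i} ↔ ⟨k, hk⟩ ∈ I := by
      simp [Finset.mem_symmDiff, hne]
    by_cases hkI : (⟨k, hk⟩ : Fin Q.length) ∈ I
    · have h1 := S.partialProd_succ_of_mem hkI
      have h2 := S.partialProd_succ_of_mem (hmem.2 hkI)
      rw [h1, h2]
      exact ih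
    · have h1 := S.partialProd_succ_of_notMem hkI
      have h2 := S.partialProd_succ_of_notMem (mt hmem.1 hkI)
      rw [h1, h2, ← mul_assoc]
      exact congrArg (· * _) ih

/-- Exchanging two positions with the same root reflection. -/
theorem partialProd_flip {i j : Fin Q.length} (hij : S.rootRefl Q I j = S.rootRefl Q I i) {k : ℕ}
    (hk : k ≤ Q.length) :
    S.partialProd Q (symmDiff (symmDiff I {i}) {j}) k =
      if (i : ℕ) < k ↔ (j : ℕ) < k then S.partialProd Q I k
      else S.rootRefl Q I i * S.partialProd Q I k := by
  have ht : S.rootRefl Q (symmDiff I {i}) j = S.rootRefl Q I i := by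
    by_cases h : (i : ℕ) < j
    · rw [rootRefl, S.partialProd_symmDiff_of_lt h j.2.le]
      exact S.conjSimple_conjSimple_mul _ _ _ _ hij
    · rw [← hij, rootRefl, S.partialProd_symmDiff_of_le (not_lt.1 h), rootRefl]
  have hsq : S.rootRefl Q I i * S.rootRefl Q I i = 1 := S.conjSimple_mul_self _ _
  by_cases h1 : (i : ℕ) < k <;> by_cases h2 : (j : ℕ) < k
  · rw [S.partialProd_symmDiff_of_lt h2 hk, ht, S.partialProd_symmDiff_of_lt h1 hk,
      ← mul_assoc, hsq, one_mul, if_pos (by tauto)]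
  · rw [S.partialProd_symmDiff_of_le (not_lt.1 h2), S.partialProd_symmDiff_of_lt h1 hk,
      if_neg (by tauto)]
  · rw [S.partialProd_symmDiff_of_lt h2 hk, ht, S.partialProd_symmDiff_of_le (not_lt.1 h1),
      if_neg (by tauto)]
  · rw [S.partialProd_symmDiff_of_le (not_lt.1 h2), S.partialProd_symmDiff_of_le (not_lt.1 h1),
      if_pos (by tauto)]

/-! ### Length, reduced subwords and the longest element. -/

theorem length_wordProd_le (L : List ι) : S.length (S.wordProd L) ≤ L.length :=
  Nat.sInf_le ⟨L, rfl, rfl⟩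

theorem wordProd_append (L M : List ι) :
    S.wordProd (L ++ M) = S.wordProd L * S.wordProd M := by
  simp [wordProd]

theorem W_induction {p : S.W → Prop} (one : p 1) (mul : ∀ w i, p w → p (w * S.simple i))
    (w : S.W) : p w := by
  obtain ⟨w, hw⟩ := w
  induction hw using Subgroup.closure_induction_right with
  | one => exact one
  | mul_right x hx y hy ih =>
    obtain ⟨i, rfl⟩ := hy
    exact mul ⟨x, hx⟩ i ih
  | mul_inv_cancel x hx y hy ih =>
    obtain ⟨i, rfl⟩ := hy
    have := mul ⟨x, hx⟩ i ih
    rw [← S.simple_inv] at this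
    exact this

theorem exists_word (w : S.W) : ∃ L : List ι, L.length = S.length w ∧ S.wordProd L = w := by
  refine Nat.sInf_mem (s := {n | ∃ L : List ι, L.length = n ∧ S.wordProd L = w}) ?_
  induction w using S.W_induction with
  | one => exact ⟨0, [], rfl, rfl⟩
  | mul w i ih =>
    obtain ⟨n, L, hL, hw⟩ := ih
    refine ⟨_, L ++ [i], rfl, ?_⟩
    rw [wordProd_append, hw]
    simp [wordProd]

theorem det_wordProd (L : List ι) :
    LinearMap.det ((S.wordProd L : V ≃ₗᵢ[ℝ] V).toLinearEquiv : V →ₗ[ℝ] V) = (-1) ^ L.length := by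
  induction L with
  | nil => exact LinearMap.det_id
  | cons i L ih =>
    have h1 : LinearMap.det ((S.simple i : V ≃ₗᵢ[ℝ] V).toLinearEquiv : V →ₗ[ℝ] V) = -1 := by
      have := Submodule.det_reflection (𝕜 := ℝ) (K := (ℝ ∙ S.root i)ᗮ)
      rw [Submodule.orthogonal_orthogonal, finrank_span_singleton (S.root.ne_zero i),
        pow_one] at this
      exact this
    rw [List.length_cons, pow_succ', ← ih, ← h1, ← LinearMap.det_comp]
    congr 1

/-- The determinant, a power of `-1`, determines the parity of the length. -/
theorem length_mul_simple_ne (w : S.W) (i : ι) : S.length (w * S.simple i) ≠ S.length w := by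
  intro h
  obtain ⟨L, hL, hw⟩ := S.exists_word w
  obtain ⟨M, hM, hw'⟩ := S.exists_word (w * S.simple i)
  have h1 : S.wordProd M = S.wordProd (L ++ [i]) := by
    rw [hw', wordProd_append, hw]
    simp [wordProd]
  have h2 := S.det_wordProd M
  rw [h1, det_wordProd, hM, h, List.length_append, hL, List.length_singleton, pow_succ] at h2
  rcases neg_one_pow_eq_or ℝ (S.length w) with h3 | h3 <;> rw [h3] at h2 <;> norm_num at h2

theorem length_subwordProd_le (A : Finset (Fin Q.length)) :
    S.length (S.subwordProd Q A) ≤ A.card := by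
  refine (S.length_wordProd_le _).trans (le_of_eq ?_)
  rw [List.length_map, ← List.toFinset_card_of_nodup ((List.nodup_finRange _).filter _)]
  congr 1
  ext
  simp

/-- Deletion property: two letters with the same reflection could both be dropped without changing
the product. -/
theorem rootRefl_injOn (hI : Iᶜ.card = S.length (S.subwordProd Q Iᶜ)) {i j : Fin Q.length}
    (hi : i ∉ I) (hj : j ∉ I) (h : S.rootRefl Q I j = S.rootRefl Q I i) : i = j := by
  by_contra hne
  have h1 := S.partialProd_flip h le_rfl
  rw [if_pos (by simp), partialProd_length, partialProd_length] at h1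
  have h2 := S.length_subwordProd_le (symmDiff (symmDiff I {i}) {j})ᶜ
  rw [h1, ← hI] at h2
  refine h2.not_gt (Finset.card_lt_card ?_)
  rw [Finset.compl_ssubset_compl]
  refine ⟨fun z hz => ?_, fun h => hi (h ?_)⟩
  · have h3 : z ≠ i := fun e => hi (e ▸ hz)
    have h4 : z ≠ j := fun e => hj (e ▸ hz)
    simp [Finset.mem_symmDiff, hz, h3, h4]
  · simp [Finset.mem_symmDiff, hi, hne]

/-- The side of a hyperplane does not change along a subword that does not cross it. -/
theorem pos_iff_of_no_crossing {u : S.W} {i : ι} {a b : ℕ} (hab : a ≤ b) (hb : b ≤ Q.length)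
    (h : ∀ z : Fin Q.length, z ∉ I → a ≤ z → z < b → S.rootRefl Q I z ≠ S.conjSimple u i) :
    0 < ⟪S.act u (S.root i), S.act (S.partialProd Q I a) S.weightSum⟫_ℝ ↔
      0 < ⟪S.act u (S.root i), S.act (S.partialProd Q I b) S.weightSum⟫_ℝ := by
  induction b, hab using Nat.le_induction with
  | base => rfl
  | succ b hab ih =>
    rw [ih (by omega) fun z h1 h2 h3 => h z h1 h2 (by omega)]
    by_cases hz : (⟨b, hb⟩ : Fin Q.length) ∈ I
    · rw [S.partialProd_succ_of_mem hz]
    · rw [S.partialProd_succ_of_notMem hz]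
      exact S.pos_iff_of_conjSimple_ne (h ⟨b, hb⟩ hz hab (Nat.lt_succ_self b))

theorem rootFn_inner_self_pos (k : Fin Q.length) :
    0 < ⟪S.rootFn Q I k, S.act (S.partialProd Q I k) S.weightSum⟫_ℝ := by
  rw [rootFn_eq, inner_act_act]
  exact S.weightSum_mem _

/-- A reduced gallery crosses the hyperplane of `j` only at `j`, so before that it is still on the
side of the base chamber. -/
theorem rootFn_pos_of_notMem (hI : Iᶜ.card = S.length (S.subwordProd Q Iᶜ)) {j : Fin Q.length}
    (hj : j ∉ I) : 0 < ⟪S.rootFn Q I j, S.weightSum⟫_ℝ := by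
  have := S.pos_iff_of_no_crossing (I := I) (u := S.partialProd Q I j) (i := Q.get j)
    (Nat.zero_le j) j.2.le fun z hz _ hzj e => by
      rw [S.rootRefl_injOn hI hj hz e] at hzj
      exact hzj.false
  rw [partialProd_zero, act_one] at this
  exact this.2 (S.rootFn_inner_self_pos j)

/-- By maximality `w₀ s_i` is shorter than `w₀`, so a reduced word for it followed by `i` is a
reduced word for `w₀`. Its last root `w₀ s_i (α_i) = -w₀ (α_i)` is positive. -/
theorem longest_root_neg (i : ι) : ⟪S.act S.longest (S.root i), S.weightSum⟫_ℝ < 0 := by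
  have hmax : ∀ u, S.length u ≤ S.length S.longest := S.exists_longest.choose_spec
  obtain ⟨L, hL, hw⟩ := S.exists_word (S.longest * S.simple i)
  have hlt : L.length < S.length S.longest :=
    hL ▸ lt_of_le_of_ne (hmax _) (S.length_mul_simple_ne _ i)
  have hprod : S.wordProd (L ++ [i]) = S.longest := by
    rw [wordProd_append, hw, mul_assoc]
    simp [wordProd, simple_mul_self]
  have hp := S.partialProd_empty (Q := L ++ [i]) le_rfl
  rw [partialProd_length, List.take_length, hprod] at hp
  have hred : (∅ : Finset (Fin (L ++ [i]).length))ᶜ.card =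
      S.length (S.subwordProd (L ++ [i]) ∅ᶜ) := by
    have h1 := S.length_subwordProd_le (Q := L ++ [i]) ∅ᶜ
    refine le_antisymm ?_ h1
    rw [hp, Finset.card_compl, Finset.card_empty, Fintype.card_fin, List.length_append]
    exact hlt
  have h1 := S.rootFn_pos_of_notMem hred (j := ⟨L.length, by simp⟩) (by simp)
  rw [rootFn_eq, S.partialProd_empty (by simp)] at h1
  simp only [List.take_left, hw, List.get_eq_getElem, List.getElem_concat_length] at h1
  rw [act_mul, act_simple_root, act_neg, inner_neg_left] at h1
  linarith

theorem longest_neg {γ : V} (h : γ ∈ S.roots) (hpos : 0 < ⟪γ, S.weightSum⟫_ℝ) :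
    ⟪γ, S.act S.longest S.weightSum⟫_ℝ < 0 := by
  refine lt_of_le_of_ne ?_ (S.inner_act_ne_zero h S.weightSum_mem _)
  by_contra! h1
  have h2 : 0 < ⟪S.act S.longest⁻¹ γ, S.weightSum⟫_ℝ := by rwa [inner_act_left, inv_inv]
  have h3 := S.inner_nonneg_of_repr_nonneg (v := -S.act S.longest⁻¹ S.weightSum)
    (S.repr_nonneg (S.act_mem_roots _ h) S.weightSum_mem h2) fun j => by
      have := S.longest_root_neg j
      rw [inner_act_left] at this
      rw [inner_neg_right]
      linarith
  rw [inner_neg_right, inner_act_act] at h3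
  linarith

theorem isReducedExpr_of_isFacet (hI : S.IsFacet Q I) : S.IsReducedExpr Q S.longest Iᶜ := by
  obtain ⟨A, hA, hred⟩ := hI.1
  have h1 : I ≤ Aᶜ := by
    rw [← Finset.compl_subset_compl, compl_compl]
    exact hA
  have h2 := hI.2 (y := Aᶜ) ⟨A, by simp, hred⟩ h1
  rw [le_antisymm h1 h2, compl_compl]
  exact hred

theorem isFacet_of_isReducedExpr (hI : S.IsReducedExpr Q S.longest Iᶜ) : S.IsFacet Q I := by
  refine ⟨⟨_, subset_rfl, hI⟩, fun J hJ hIJ => ?_⟩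
  obtain ⟨A, hA, hred⟩ := hJ
  have h1 : A ⊆ Iᶜ := hA.trans (Finset.compl_subset_compl.2 hIJ)
  rw [Finset.eq_of_subset_of_card_le h1 (by rw [hI.2, hred.2])] at hA
  exact Finset.compl_subset_compl.1 hA

variable {S}

theorem IsFacet.subwordProd (hI : S.IsFacet Q I) : S.subwordProd Q Iᶜ = S.longest :=
  (S.isReducedExpr_of_isFacet hI).1

theorem IsFacet.card_compl (hI : S.IsFacet Q I) : Iᶜ.card = S.length S.longest :=
  (S.isReducedExpr_of_isFacet hI).2

theorem IsFacet.reduced (hI : S.IsFacet Q I) : Iᶜ.card = S.length (S.subwordProd Q Iᶜ) := by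
  rw [hI.subwordProd, hI.card_compl]

theorem IsFacet.partialProd_length (hI : S.IsFacet Q I) :
    S.partialProd Q I Q.length = S.longest := by
  rw [S.partialProd_length, hI.subwordProd]

/-- The complement of a facet crosses every hyperplane. -/
theorem IsFacet.exists_rootRefl_eq (hI : S.IsFacet Q I) (u : S.W) (i : ι) :
    ∃ j, j ∉ I ∧ S.rootRefl Q I j = S.conjSimple u i := by
  by_contra! h
  have h1 := S.pos_iff_of_no_crossing (Nat.zero_le _) le_rfl fun z hz _ _ => h z hz
  rw [hI.partialProd_length, partialProd_zero, act_one] at h1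
  have hr := S.act_root_mem_roots u i
  rcases lt_or_gt_of_ne (S.inner_ne_zero hr S.weightSum_mem) with h2 | h2
  · have h3 := S.longest_neg (S.neg_mem_roots hr) (by rw [inner_neg_left]; linarith)
    rw [inner_neg_left] at h3
    exact h2.not_gt (h1.2 (by linarith))
  · exact (S.longest_neg hr h2).not_gt (h1.1 h2)

end

/-! ### Facets, flips and brick vectors. -/

section

variable {Q : List ι} {I : Finset (Fin Q.length)}

theorem _root_.Finset.mem_symmDiff_pair_iff {α : Type*} [DecidableEq α] {I : Finset α} {i j : α}
    (hi : i ∈ I) (hj : j ∉ I) (z : α) :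
    z ∈ symmDiff (symmDiff I {i}) {j} ↔ z = j ∨ (z ∈ I ∧ z ≠ i) := by
  have hij : i ≠ j := fun e => hj (e ▸ hi)
  by_cases h1 : z = i
  · subst h1
    simp [Finset.mem_symmDiff, hi, hij]
  · by_cases h2 : z = j
    · subst h2
      simp [Finset.mem_symmDiff, hj, h1]
    · simp [Finset.mem_symmDiff, h1, h2]

theorem rootRefl_inv (k : Fin Q.length) : (S.rootRefl Q I k)⁻¹ = S.rootRefl Q I k :=
  inv_eq_of_mul_eq_one_left (S.conjSimple_mul_self _ _)

/-- The letters kept by the Demazure recursion each raise the length by one, hence form a reduced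
subword; `I` holds the skipped positions and those not yet read. -/
theorem exists_reduced_subword {k : ℕ} (hk : k ≤ Q.length) :
    ∃ I : Finset (Fin Q.length), (∀ z : Fin Q.length, k ≤ z → z ∈ I) ∧
      S.partialProd Q I k = S.demazure (Q.take k) ∧
      Iᶜ.card = S.length (S.demazure (Q.take k)) := by
  induction k with
  | zero =>
    refine ⟨Finset.univ, by simp, by simp [partialProd_zero, demazure], ?_⟩
    have := S.length_wordProd_le []
    simpa [wordProd, demazure, eq_comm] using this
  | succ k ih =>
    obtain ⟨I, h1, h2, h3⟩ := ih (by omega)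
    have hdem : S.demazure (Q.take (k + 1)) =
        if S.length (S.demazure (Q.take k) * S.simple Q[k]) =
            S.length (S.demazure (Q.take k)) + 1
        then S.demazure (Q.take k) * S.simple Q[k] else S.demazure (Q.take k) := by
      rw [List.take_succ_eq_append_getElem hk]
      simp only [demazure, List.foldl_append, List.foldl_cons, List.foldl_nil]
      rfl
    have hkI : (⟨k, hk⟩ : Fin Q.length) ∈ I := h1 _ le_rfl
    by_cases hl : S.length (S.demazure (Q.take k) * S.simple Q[k]) =
        S.length (S.demazure (Q.take k)) + 1
    · rw [if_pos hl] at hdem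
      refine ⟨I.erase ⟨k, hk⟩, fun z hz => ?_, ?_, ?_⟩
      · refine Finset.mem_erase.2 ⟨fun e => ?_, h1 z (by omega)⟩
        rw [e] at hz
        simp at hz
      · have := S.partialProd_succ_of_notMem (Q := Q) (k := ⟨k, hk⟩)
          (I := I.erase ⟨k, hk⟩) (by simp)
        rw [this, hdem, ← h2]
        congr 1
        refine S.partialProd_congr fun z hz => ?_
        have : z ≠ ⟨k, hk⟩ := fun e => by rw [e] at hz; simp at hz
        simp [this]
      · rw [Finset.compl_erase, Finset.card_insert_of_notMem (by simpa using hkI), h3, hdem, hl]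
    · rw [if_neg hl] at hdem
      refine ⟨I, fun z hz => h1 z (by omega), ?_, by rw [hdem, h3]⟩
      have := S.partialProd_succ_of_mem hkI
      rw [hdem, ← h2]
      exact this

theorem exists_isFacet (hQ : S.demazure Q = S.longest) :
    ∃ I : Finset (Fin Q.length), S.IsFacet Q I := by
  obtain ⟨I, -, h2, h3⟩ := S.exists_reduced_subword (Q := Q) le_rfl
  rw [List.take_length, hQ] at h2 h3
  exact ⟨I, S.isFacet_of_isReducedExpr ⟨by rw [← h2, partialProd_length], h3⟩⟩

/-- Any point `v` of the open chamber may serve as the test: both `weightSum` and generic points are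
used below. -/
theorem rootConfigSubset_iff {v : V} (hv : v ∈ S.openChamber) (w : S.W) :
    S.RootConfigSubset Q I w ↔ ∀ i ∈ I, 0 < ⟪S.rootFn Q I i, S.act w v⟫_ℝ := by
  refine forall₂_congr fun i _ => ?_
  rw [S.mem_act_posRoots_iff hv]
  exact and_iff_right (S.rootFn_mem_roots i)

variable {S}

theorem IsFacet.flip (hI : S.IsFacet Q I) {i j : Fin Q.length} (hi : i ∈ I) (hj : j ∉ I)
    (h : S.rootRefl Q I j = S.rootRefl Q I i) :
    S.IsFacet Q (symmDiff (symmDiff I {i}) {j}) := by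
  refine S.isFacet_of_isReducedExpr ⟨?_, ?_⟩
  · rw [← S.partialProd_length, S.partialProd_flip h le_rfl, if_pos (by simp),
      hI.partialProd_length]
  · rw [← hI.card_compl, Finset.card_compl, Finset.card_compl]
    have : symmDiff (symmDiff I {i}) {j} = insert j (I.erase i) := by
      ext z
      rw [Finset.mem_symmDiff_pair_iff hi hj]
      simp [and_comm]
    rw [this, Finset.card_insert_of_notMem (by simp [hj]), Finset.card_erase_add_one hi]

theorem rootFn_flip {i j : Fin Q.length} (h : S.rootRefl Q I j = S.rootRefl Q I i)
    (k : Fin Q.length) :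
    S.rootFn Q (symmDiff (symmDiff I {i}) {j}) k =
      if (i : ℕ) < k ↔ (j : ℕ) < k then S.rootFn Q I k
      else S.act (S.rootRefl Q I i) (S.rootFn Q I k) := by
  rw [rootFn_eq, S.partialProd_flip h k.2.le]
  split_ifs
  · rfl
  · rfl

theorem rootRefl_flip_eq_iff {i j : Fin Q.length} (h : S.rootRefl Q I j = S.rootRefl Q I i)
    (k : Fin Q.length) :
    S.rootRefl Q (symmDiff (symmDiff I {i}) {j}) k = S.rootRefl Q I i ↔
      S.rootRefl Q I k = S.rootRefl Q I i := by
  have e : S.rootRefl Q (symmDiff (symmDiff I {i}) {j}) k =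
      S.conjSimple (S.partialProd Q (symmDiff (symmDiff I {i}) {j}) k) (Q.get k) := rfl
  rw [e, S.partialProd_flip h k.2.le]
  split_ifs
  · rfl
  · rw [conjSimple_mul, mul_inv_eq_iff_eq_mul, mul_right_inj]
    rfl

/-- A flip moves the brick vector in the direction opposite to the flipped root. -/
theorem IsFacet.brickVector_flip (hI : S.IsFacet Q I) {i j : Fin Q.length} (hi : i ∈ I)
    (hj : j ∉ I) (h : S.rootRefl Q I j = S.rootRefl Q I i) :
    ∃ c : ℝ, 0 < c ∧ S.brickVector Q (symmDiff (symmDiff I {i}) {j}) =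
      S.brickVector Q I - c • S.rootFn Q I i := by
  have hij : (i : ℕ) ≠ j := fun e => hj (Fin.ext e ▸ hi)
  have hα := S.inner_root_self_pos (Q.get i)
  set β := S.rootFn Q I i with hβ
  have hβr : β ∈ S.roots := S.rootFn_mem_roots i
  set d : Fin Q.length → ℝ := fun k =>
    2 * ⟪β, S.weightFn Q I k⟫_ℝ / ⟪S.root (Q.get i), S.root (Q.get i)⟫_ℝ with hd
  set c : Fin Q.length → ℝ := fun k => if (i : ℕ) < k ↔ (j : ℕ) < k then 0 else d k with hc
  have hw : ∀ k, S.weightFn Q (symmDiff (symmDiff I {i}) {j}) k =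
      S.weightFn Q I k - c k • β := by
    intro k
    have e : S.weightFn Q (symmDiff (symmDiff I {i}) {j}) k =
      S.act (S.partialProd Q (symmDiff (symmDiff I {i}) {j}) k) (S.weight (Q.get k)) := rfl
    rw [e, S.partialProd_flip h k.2.le]
    simp only [hc]
    split_ifs
    · rw [zero_smul, sub_zero]
      rfl
    · rw [act_mul]
      exact S.act_conjSimple _ _ _
  have huniq : ∀ z : Fin Q.length, z ∉ I →
      S.rootRefl Q I z = S.conjSimple (S.partialProd Q I i) (Q.get i) → z = j :=
    fun z hz e => S.rootRefl_injOn hI.reduced hz hj (h.trans e.symm)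
  -- Only positions `k` with `i < k ≤ j` or `j < k ≤ i` are moved. The gallery meets the hyperplane
  -- of `β` only at `j`, so throughout this window it is on the same side as at `i`.
  have hpos : ∀ k : Fin Q.length, ¬((i : ℕ) < k ↔ (j : ℕ) < k) →
      0 < ⟪β, S.act (S.partialProd Q I k) S.weightSum⟫_ℝ := by
    intro k hk
    have h0 := S.rootFn_inner_self_pos (I := I) i
    by_cases hik : (i : ℕ) < k
    · refine (S.pos_iff_of_no_crossing hik.le k.2.le fun z hz _ hzk e => ?_).1 h0
      have := huniq z hz e
      subst this
      tauto
    · refine (S.pos_iff_of_no_crossing (not_lt.1 hik) i.2.le fun z hz hkz _ e => ?_).2 h0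
      have := huniq z hz e
      subst this
      omega
  have hdpos : ∀ k, 0 < ⟪β, S.weightFn Q I k⟫_ℝ → 0 < d k := fun k hk => by
    rw [hd]
    positivity
  refine ⟨∑ k, c k, Finset.sum_pos' (fun k _ => ?_) ?_, ?_⟩
  · simp only [hc]
    split_ifs with hk
    · exact le_rfl
    · have := S.inner_weight_nonneg hβr _ (Q.get k) (hpos k hk)
      exact div_nonneg (mul_nonneg zero_le_two this) hα.le
  -- The strict contribution comes from the larger of `i` and `j`: it lies in the window, and its
  -- root is a multiple of `β`.
  · rcases lt_or_gt_of_ne hij with hlt | hlt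
    · refine ⟨j, Finset.mem_univ _, ?_⟩
      have hk : ¬((i : ℕ) < j ↔ (j : ℕ) < j) := by simp [hlt]
      simp only [hc, if_neg hk]
      obtain ⟨a, -, ha⟩ := (S.conjSimple_eq_iff _ _ _ _).1 h.symm
      exact hdpos _ (S.inner_weight_pos _ _ ha (hpos j hk))
    · refine ⟨i, Finset.mem_univ _, ?_⟩
      have hk : ¬((i : ℕ) < i ↔ (j : ℕ) < i) := by simp [hlt]
      simp only [hc, if_neg hk]
      exact hdpos _ (S.inner_weight_pos _ _ (one_smul ℝ _).symm (hpos i hk))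
  · rw [brickVector, Finset.sum_congr rfl fun k _ => hw k, Finset.sum_sub_distrib,
      ← Finset.sum_smul]
    rfl

theorem IsFacet.exists_flip (hI : S.IsFacet Q I) {i : Fin Q.length} (hi : i ∈ I) :
    ∃ J, S.IsFacet Q J ∧ ∃ c : ℝ, 0 < c ∧
      S.brickVector Q J = S.brickVector Q I - c • S.rootFn Q I i := by
  obtain ⟨j, hj, h⟩ := hI.exists_rootRefl_eq (S.partialProd Q I i) (Q.get i)
  exact ⟨_, hI.flip hi hj h, hI.brickVector_flip hi hj h⟩

theorem IsFacet.inner_rootFn_nonneg (hI : S.IsFacet Q I) {v : V}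
    (hmax : ∀ J, S.IsFacet Q J → ⟪S.brickVector Q J, v⟫_ℝ ≤ ⟪S.brickVector Q I, v⟫_ℝ)
    {i : Fin Q.length} (hi : i ∈ I) : 0 ≤ ⟪S.rootFn Q I i, v⟫_ℝ := by
  obtain ⟨J, hJ, c, hc, hB⟩ := hI.exists_flip hi
  have := hmax J hJ
  rw [hB, inner_sub_left, inner_smul_left] at this
  simp only [conj_trivial] at this
  exact nonneg_of_mul_nonneg_right (by linarith) hc

theorem IsFacet.rootConfigSubset_of_max (hI : S.IsFacet Q I) {v : V} (hv : v ∈ S.openChamber)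
    (w : S.W) (hmax : ∀ J, S.IsFacet Q J →
      ⟪S.brickVector Q J, S.act w v⟫_ℝ ≤ ⟪S.brickVector Q I, S.act w v⟫_ℝ) :
    S.RootConfigSubset Q I w :=
  (S.rootConfigSubset_iff hv w).2 fun i hi => lt_of_le_of_ne (hI.inner_rootFn_nonneg hmax hi)
    (S.inner_act_ne_zero (S.rootFn_mem_roots i) hv w).symm

theorem IsFacet.exists_max_brickVector (hI : S.IsFacet Q I) (v : V) :
    ∃ I, S.IsFacet Q I ∧
      ∀ J, S.IsFacet Q J → ⟪S.brickVector Q J, v⟫_ℝ ≤ ⟪S.brickVector Q I, v⟫_ℝ := by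
  obtain ⟨I, hI, hmax⟩ := Set.exists_max_image {I | S.IsFacet Q I}
    (fun I => ⟪S.brickVector Q I, v⟫_ℝ) (Set.toFinite _) ⟨I, hI⟩
  exact ⟨I, hI, hmax⟩

/-! ### Uniqueness of the facet attached to a group element. -/

/-- All roots `r(I, k)` are positive here, inside and outside `I`; a letter outside `I` then makes
its root negative. So the product up to and including `k` decides whether `k ∈ I`, which allows
reconstruction from the right, starting at `w₀`. -/
theorem IsFacet.mem_iff_of_rootConfigSubset_one (hI : S.IsFacet Q I)
    (h : S.RootConfigSubset Q I 1) (k : Fin Q.length) :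
    k ∈ I ↔ 0 < ⟪S.act (S.partialProd Q I (k + 1)) (S.root (Q.get k)), S.weightSum⟫_ℝ := by
  by_cases hk : k ∈ I
  · rw [S.partialProd_succ_of_mem hk]
    exact iff_of_true hk ((S.rootConfigSubset_iff S.weightSum_mem 1).1 h k hk)
  · rw [S.partialProd_succ_of_notMem hk, act_mul, act_simple_root, act_neg, inner_neg_left]
    have := S.rootFn_pos_of_notMem hI.reduced hk
    rw [rootFn_eq] at this
    exact iff_of_false hk (by linarith)

theorem IsFacet.eq_of_rootConfigSubset_one {J : Finset (Fin Q.length)} (hI : S.IsFacet Q I)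
    (hJ : S.IsFacet Q J) (hI1 : S.RootConfigSubset Q I 1) (hJ1 : S.RootConfigSubset Q J 1) :
    I = J := by
  have key : ∀ k ≤ Q.length, S.partialProd Q I k = S.partialProd Q J k ∧
      ∀ z : Fin Q.length, k ≤ z → (z ∈ I ↔ z ∈ J) := by
    intro k hk
    induction hk using Nat.decreasingInduction with
    | self =>
      refine ⟨by rw [hI.partialProd_length, hJ.partialProd_length], fun z hz => ?_⟩
      exact absurd z.2 (not_lt.2 hz)
    | of_succ k hk ih =>
      have hm : (⟨k, hk⟩ : Fin Q.length) ∈ I ↔ (⟨k, hk⟩ : Fin Q.length) ∈ J := by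
        rw [hI.mem_iff_of_rootConfigSubset_one hI1, hJ.mem_iff_of_rootConfigSubset_one hJ1,
          ih.1]
      refine ⟨?_, fun z hz => ?_⟩
      · by_cases h : (⟨k, hk⟩ : Fin Q.length) ∈ I
        · have h1 := S.partialProd_succ_of_mem h
          have h2 := S.partialProd_succ_of_mem (hm.1 h)
          exact h1.symm.trans (ih.1.trans h2)
        · have h1 := S.partialProd_succ_of_notMem h
          have h2 := S.partialProd_succ_of_notMem (mt hm.2 h)
          exact mul_right_cancel (h1.symm.trans (ih.1.trans h2))
      · rcases eq_or_lt_of_le hz with e | hlt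
        · rwa [show z = ⟨k, hk⟩ from Fin.ext e.symm]
        · exact ih.2 z hlt
  ext z
  exact (key 0 (Nat.zero_le _)).2 z (Nat.zero_le _)

theorem IsRealizing.rootRefl_injOn (hreal : S.IsRealizing Q) (hI : S.IsFacet Q I)
    {i j : Fin Q.length} (hi : i ∈ I) (hj : j ∈ I) (h : S.rootRefl Q I i = S.rootRefl Q I j) :
    i = j := by
  obtain ⟨c, -, hc⟩ := (S.conjSimple_eq_iff _ _ _ _).1 h
  have hli := (hreal I hI).1
  have := @hli (Finsupp.single ⟨i, hi⟩ 1) (Finsupp.single ⟨j, hj⟩ c)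
    (by simpa [Finsupp.linearCombination_single, rootFn_eq] using hc)
  rcases (Finsupp.single_eq_single_iff _ _ _ _).1 this with ⟨h, -⟩ | ⟨h, -⟩
  · exact congrArg Subtype.val h
  · exact absurd h one_ne_zero

open scoped Classical in
variable (S Q) in
/-- The flip of `I` across the hyperplane of `w (α_i)`, if this is the hyperplane of one of the
roots in the root configuration of `I`. -/
def crossFlip (w : S.W) (i : ι) (I : Finset (Fin Q.length)) : Finset (Fin Q.length) :=
  if ∃ z ∈ I, S.rootRefl Q I z = S.conjSimple w i then
    symmDiff I (Finset.univ.filter fun z => S.rootRefl Q I z = S.conjSimple w i)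
  else I

theorem IsRealizing.crossFlip_eq (hreal : S.IsRealizing Q) (hI : S.IsFacet Q I) {w : S.W}
    {i : ι} {a b : Fin Q.length} (ha : a ∈ I) (hb : b ∉ I)
    (hta : S.rootRefl Q I a = S.conjSimple w i) (htb : S.rootRefl Q I b = S.conjSimple w i) :
    S.crossFlip Q w i I = symmDiff (symmDiff I {a}) {b} := by
  rw [crossFlip, if_pos ⟨a, ha, hta⟩]
  ext z
  rw [Finset.mem_symmDiff_pair_iff ha hb, Finset.mem_symmDiff]
  simp only [Finset.mem_filter, Finset.mem_univ, true_and]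
  constructor
  · rintro (⟨h1, h2⟩ | ⟨h1, h2⟩)
    · exact Or.inr ⟨h1, fun e => h2 (e ▸ hta)⟩
    · exact Or.inl (S.rootRefl_injOn hI.reduced h2 hb (htb.trans h1.symm))
  · rintro (rfl | ⟨h1, h2⟩)
    · exact Or.inr ⟨htb, hb⟩
    · exact Or.inl ⟨h1, fun e => h2 (hreal.rootRefl_injOn hI h1 ha (e.trans hta.symm))⟩

/-- Only the hyperplane of `w (α_i)` separates the chambers of `w s_i` and `w`, so only a root of
`R(I)` normal to it needs to be flipped. The involution clause makes the map injective, which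
transports uniqueness across the wall. -/
theorem IsRealizing.crossFlip_spec (hreal : S.IsRealizing Q) (hI : S.IsFacet Q I) {w : S.W}
    {i : ι} (hw : S.RootConfigSubset Q I (w * S.simple i)) :
    S.IsFacet Q (S.crossFlip Q w i I) ∧ S.RootConfigSubset Q (S.crossFlip Q w i I) w ∧
      S.crossFlip Q w i (S.crossFlip Q w i I) = I := by
  rw [S.rootConfigSubset_iff S.weightSum_mem] at hw
  by_cases hex : ∃ z ∈ I, S.rootRefl Q I z = S.conjSimple w i
  · obtain ⟨a, ha, hta⟩ := hex
    obtain ⟨b, hb, htb⟩ := hI.exists_rootRefl_eq w i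
    have hab := htb.trans hta.symm
    rw [hreal.crossFlip_eq hI ha hb hta htb]
    set J := symmDiff (symmDiff I {a}) {b} with hJdef
    have hJ : S.IsFacet Q J := hI.flip ha hb hab
    have hbJ : b ∈ J := (Finset.mem_symmDiff_pair_iff ha hb b).2 (Or.inl rfl)
    have haJ : a ∉ J := fun h => by
      rcases (Finset.mem_symmDiff_pair_iff ha hb a).1 h with h | h
      · exact hb (h ▸ ha)
      · exact h.2 rfl
    have htbJ : S.rootRefl Q J b = S.conjSimple w i := by
      rw [← hta]
      exact (rootRefl_flip_eq_iff hab b).2 hab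
    have htaJ : S.rootRefl Q J a = S.conjSimple w i := by
      rw [← hta]
      exact (rootRefl_flip_eq_iff hab a).2 rfl
    have hJI : symmDiff (symmDiff J {b}) {a} = I := by
      rw [hJdef, symmDiff_symmDiff_cancel_right, symmDiff_symmDiff_cancel_right]
    refine ⟨hJ, ?_, ?_⟩
    · rw [S.rootConfigSubset_iff S.weightSum_mem]
      intro z hz
      rcases (Finset.mem_symmDiff_pair_iff ha hb z).1 hz with rfl | ⟨hzI, hza⟩
      · obtain ⟨c, hc, h1⟩ := hI.brickVector_flip ha hb hab
        obtain ⟨c', hc', h2⟩ := hJ.brickVector_flip hbJ haJ (htaJ.trans htbJ.symm)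
        rw [← hJdef] at h1
        rw [hJI] at h2
        -- The flip and its inverse displace the brick vector by opposite amounts, so the new root
        -- points opposite to the old one.
        have h3 : c' • S.rootFn Q J z = -(c • S.rootFn Q I a) := by
          rw [h1] at h2
          calc _ = (S.brickVector Q I - c • S.rootFn Q I a) -
                (S.brickVector Q I - c • S.rootFn Q I a - c' • S.rootFn Q J z) := by abel
            _ = _ := by rw [← h2]; abel
        have h4 := hw a ha
        have h5 : ⟪S.rootFn Q I a, S.act (w * S.simple i) S.weightSum⟫_ℝ =
            -⟪S.rootFn Q I a, S.act w S.weightSum⟫_ℝ := by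
          have e : w * S.simple i = S.rootRefl Q I a * w := by
            rw [hta, conjSimple]
            group
          have h6 : S.act (S.rootRefl Q I a)⁻¹ (S.rootFn Q I a) = -S.rootFn Q I a := by
            rw [rootRefl_inv]
            exact S.act_conjSimple_root _ _
          rw [e, act_mul, real_inner_comm, inner_act_left, h6, inner_neg_right, real_inner_comm]
        have h7 : c' * ⟪S.rootFn Q J z, S.act w S.weightSum⟫_ℝ =
            c * ⟪S.rootFn Q I a, S.act (w * S.simple i) S.weightSum⟫_ℝ := by
          have := congrArg (fun x => ⟪x, S.act w S.weightSum⟫_ℝ) h3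
          simp only [inner_neg_left, inner_smul_left, conj_trivial] at this
          rw [this, h5]
          ring
        exact pos_of_mul_pos_right (h7 ▸ mul_pos hc h4) hc'.le
      · have hzw := hw z hzI
        have hne : S.conjSimple w i ≠ S.rootRefl Q I z := fun e =>
          hza (hreal.rootRefl_injOn hI hzI ha (e.symm.trans hta.symm))
        rw [rootFn_flip hab]
        split_ifs
        · exact (S.pos_iff_of_conjSimple_ne hne).2 hzw
        -- A root between the flipped positions is reflected, and the same reflection turns `w` into
        -- `w s_i`.
        · rw [inner_act_left, rootRefl_inv, ← act_mul]
          have e : S.rootRefl Q I a * w = w * S.simple i := by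
            rw [hta, conjSimple]
            group
          exact e ▸ hzw
    · rw [hreal.crossFlip_eq hJ hbJ haJ htbJ htaJ, hJI]
  · have e : S.crossFlip Q w i I = I := if_neg hex
    rw [e, e]
    refine ⟨hI, (S.rootConfigSubset_iff S.weightSum_mem w).2 fun z hz => ?_, rfl⟩
    exact (S.pos_iff_of_conjSimple_ne fun h => hex ⟨z, hz, h.symm⟩).2 (hw z hz)

theorem IsRealizing.eq_of_rootConfigSubset (hreal : S.IsRealizing Q) (w : S.W)
    {I J : Finset (Fin Q.length)} (hI : S.IsFacet Q I) (hJ : S.IsFacet Q J)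
    (hIw : S.RootConfigSubset Q I w) (hJw : S.RootConfigSubset Q J w) : I = J := by
  induction w using S.W_induction generalizing I J with
  | one => exact hI.eq_of_rootConfigSubset_one hJ hIw hJw
  | mul w i ih =>
    obtain ⟨h1, h2, h3⟩ := hreal.crossFlip_spec hI hIw
    obtain ⟨h4, h5, h6⟩ := hreal.crossFlip_spec hJ hJw
    rw [← h3, ← h6, ih h1 h4 h2 h5]

end

/-! ### Chambers of the arrangement. -/

section

open Filter Topology

/-- This and the next two lemmas say that the first non-zero coefficient governs the sign for small
`ε > 0`; they control the perturbation `v + ε u + ε² ρ`. -/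
theorem _root_.eventually_pos_of_pos {a : ℝ} (b c : ℝ) (ha : 0 < a) :
    ∀ᶠ ε in 𝓝[>] (0 : ℝ), 0 < a + ε * b + ε ^ 2 * c := by
  have h : Continuous fun ε : ℝ => a + ε * b + ε ^ 2 * c := by fun_prop
  refine Filter.Eventually.filter_mono nhdsWithin_le_nhds (h.continuousAt.eventually_const_lt ?_)
  simpa using ha

theorem _root_.eventually_pos_of_nonneg_of_pos {a b : ℝ} (c : ℝ) (ha : 0 ≤ a) (hb : 0 < b) :
    ∀ᶠ ε in 𝓝[>] (0 : ℝ), 0 < a + ε * b + ε ^ 2 * c := by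
  filter_upwards [eventually_pos_of_pos c 0 hb, self_mem_nhdsWithin] with ε h hε
  have h1 : 0 < ε * (b + ε * c + ε ^ 2 * 0) := mul_pos hε h
  nlinarith

theorem _root_.eventually_ne_zero_of_ne_zero (a b : ℝ) {c : ℝ} (hc : c ≠ 0) :
    ∀ᶠ ε in 𝓝[>] (0 : ℝ), a + ε * b + ε ^ 2 * c ≠ 0 := by
  rcases lt_trichotomy a 0 with ha | rfl | ha
  · filter_upwards [eventually_pos_of_pos (-b) (-c) (neg_pos.2 ha)] with ε h
    intro h0
    linarith
  · rcases lt_trichotomy b 0 with hb | rfl | hb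
    · filter_upwards [eventually_pos_of_nonneg_of_pos (-c) le_rfl (neg_pos.2 hb)] with ε h
      intro h0
      linarith
    · filter_upwards [self_mem_nhdsWithin] with ε hε
      simpa using ⟨(Set.mem_Ioi.1 hε).ne', hc⟩
    · filter_upwards [eventually_pos_of_nonneg_of_pos c le_rfl hb] with ε h using h.ne'
  · filter_upwards [eventually_pos_of_pos b c ha] with ε h using h.ne'

theorem mem_act_fundamentalChamber_iff (w : S.W) (v : V) :
    v ∈ S.act w '' S.fundamentalChamber ↔ ∀ i, 0 ≤ ⟪S.act w (S.root i), v⟫_ℝ := by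
  constructor
  · rintro ⟨x, hx, rfl⟩ i
    rw [inner_act_act]
    exact hx i
  · intro h
    refine ⟨S.act w⁻¹ v, fun i => ?_, by simp⟩
    rw [← inner_act_left]
    exact h i

theorem mem_act_openChamber_iff (w : S.W) (v : V) :
    v ∈ S.act w '' S.openChamber ↔ ∀ i, 0 < ⟪S.act w (S.root i), v⟫_ℝ := by
  constructor
  · rintro ⟨x, hx, rfl⟩ i
    rw [inner_act_act]
    exact hx i
  · intro h
    refine ⟨S.act w⁻¹ v, fun i => ?_, by simp⟩
    rw [← inner_act_left]
    exact h i

theorem exists_mem_act_fundamentalChamber (v : V) :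
    ∃ w : S.W, v ∈ S.act w '' S.fundamentalChamber := by
  -- At the point of the orbit of `v` closest to `ρ`, no simple reflection can increase the pairing
  -- with `ρ`, which forces membership in the chamber.
  obtain ⟨w, hw⟩ := Finite.exists_max fun w : S.W => ⟪S.act w⁻¹ v, S.weightSum⟫_ℝ
  refine ⟨w, S.act w⁻¹ v, fun i => ?_, by simp⟩
  have h := hw (w * S.simple i)
  rw [mul_inv_rev, simple_inv, act_mul, act_simple, inner_sub_left, inner_smul_left] at h
  simp only [conj_trivial] at h
  have h1 := S.weightSum_mem i
  have h2 : 0 ≤ 2 * ⟪S.root i, S.act w⁻¹ v⟫_ℝ / ⟪S.root i, S.root i⟫_ℝ :=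
    nonneg_of_mul_nonneg_left (by linarith) h1
  have h3 : 0 ≤ 2 * ⟪S.root i, S.act w⁻¹ v⟫_ℝ := by
    have := mul_nonneg h2 (S.inner_root_self_pos i).le
    rwa [div_mul_cancel₀ _ (S.inner_root_self_pos i).ne'] at this
  linarith

theorem closure_openChamber : closure S.openChamber = S.fundamentalChamber := by
  refine Set.Subset.antisymm (closure_minimal S.openChamber_subset ?_) fun x hx => ?_
  · have : S.fundamentalChamber = ⋂ i, {v | 0 ≤ ⟪S.root i, v⟫_ℝ} := by
      ext
      simp [fundamentalChamber]
    rw [this]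
    exact isClosed_iInter fun i => isClosed_le continuous_const (by fun_prop)
  · have h : Continuous fun ε : ℝ => x + ε • S.weightSum := by fun_prop
    have ht : Tendsto (fun ε : ℝ => x + ε • S.weightSum) (𝓝[>] 0) (𝓝 x) := by
      have := (h.tendsto 0).mono_left (nhdsWithin_le_nhds (s := Set.Ioi 0))
      simpa using this
    refine mem_closure_of_tendsto ht ?_
    filter_upwards [self_mem_nhdsWithin] with ε hε i
    rw [inner_add_right, inner_smul_right]
    exact add_pos_of_nonneg_of_pos (hx i) (mul_pos hε (S.weightSum_mem i))

theorem closure_act_openChamber (w : S.W) :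
    closure (S.act w '' S.openChamber) = S.act w '' S.fundamentalChamber := by
  rw [← closure_openChamber]
  exact ((w : V ≃ₗᵢ[ℝ] V).toHomeomorph.image_closure _).symm

theorem inner_ne_zero_of_mem_arrangementComplement {v : V} (h : v ∈ S.arrangementComplement)
    {β : V} (hβ : β ∈ S.roots) : ⟪β, v⟫_ℝ ≠ 0 :=
  h β (S.ne_zero_of_mem_roots hβ) (S.hyperplaneReflection_mem hβ)

/-- The arrangement involves every reflection in `W`, not only those of `Φ`; conjugating by `w`
reduces to `isChamber`. -/
theorem act_openChamber_subset (w : S.W) :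
    S.act w '' S.openChamber ⊆ S.arrangementComplement := by
  rintro _ ⟨x, hx, rfl⟩ β hβ hW
  have h1 : ⟪β, S.act w x⟫_ℝ = ⟪S.act w⁻¹ β, x⟫_ℝ := by rw [inner_act_left, inv_inv]
  rw [h1]
  refine S.isChamber _ (fun h => hβ ?_) ?_ x hx
  · rw [← S.act_act_inv w β, h]
    exact map_zero (w : V ≃ₗᵢ[ℝ] V)
  · have : hyperplaneReflection (S.act w⁻¹ β) =
        ((w⁻¹ * ⟨hyperplaneReflection β, hW⟩ * w : S.W) : V ≃ₗᵢ[ℝ] V) := by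
      ext v
      change _ = S.act (w⁻¹ * ⟨hyperplaneReflection β, hW⟩ * w) v
      have h2 : ∀ y, S.act ⟨hyperplaneReflection β, hW⟩ y =
        y - (2 * ⟪β, y⟫_ℝ / ⟪β, β⟫_ℝ) • β := hyperplaneReflection_apply β
      rw [hyperplaneReflection_apply, inner_act_act, act_mul, act_mul, h2, act_sub, act_smul,
        act_inv_act, inner_act_left, inv_inv]
    rw [this]
    exact Subtype.property _

theorem connectedComponentIn_eq {w : S.W} {x : V} (hx : x ∈ S.act w '' S.openChamber) :
    connectedComponentIn S.arrangementComplement x = S.act w '' S.openChamber := by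
  refine Set.Subset.antisymm (fun y hy => ?_) ?_
  · rw [mem_act_openChamber_iff] at hx ⊢
    intro i
    by_contra! hneg
    have hx' : x ∈ connectedComponentIn S.arrangementComplement x :=
      mem_connectedComponentIn (S.act_openChamber_subset w ((S.mem_act_openChamber_iff w x).2 hx))
    have hcont : Continuous fun y : V => ⟪S.act w (S.root i), y⟫_ℝ := by fun_prop
    obtain ⟨z, hz, hz0⟩ := isPreconnected_connectedComponentIn.intermediate_value hy hx'
      hcont.continuousOn ⟨hneg, (hx i).le⟩
    exact S.inner_ne_zero_of_mem_arrangementComplement (connectedComponentIn_subset _ _ hz)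
      (S.act_root_mem_roots w i) hz0
  · refine IsPreconnected.subset_connectedComponentIn ?_ hx (S.act_openChamber_subset w)
    have : S.act w '' S.openChamber = ⋂ i, {v | 0 < ⟪S.act w (S.root i), v⟫_ℝ} := by
      ext v
      rw [mem_act_openChamber_iff]
      simp
    rw [this]
    exact (convex_iInter fun i => convex_halfSpace_gt
      (innerₛₗ ℝ (S.act w (S.root i))).isLinear 0).isPreconnected

theorem chambers_eq : S.chambers = Set.range fun w : S.W => S.act w '' S.fundamentalChamber := by
  ext D
  constructor
  · rintro ⟨x, hx, rfl⟩
    obtain ⟨w, hw⟩ := S.exists_mem_act_fundamentalChamber x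
    refine ⟨w, ?_⟩
    have hx' : x ∈ S.act w '' S.openChamber := by
      rw [mem_act_fundamentalChamber_iff] at hw
      rw [mem_act_openChamber_iff]
      exact fun i => lt_of_le_of_ne (hw i)
        (S.inner_ne_zero_of_mem_arrangementComplement hx (S.act_root_mem_roots w i)).symm
    simp only [S.connectedComponentIn_eq hx', closure_act_openChamber]
  · rintro ⟨w, rfl⟩
    have hx : S.act w S.weightSum ∈ S.act w '' S.openChamber := ⟨_, S.weightSum_mem, rfl⟩
    exact ⟨_, S.act_openChamber_subset w hx,
      by simp only [S.connectedComponentIn_eq hx, closure_act_openChamber]⟩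

/-! ### Normal cones of the brick polytope and the refinement of fans. -/

variable {Q : List ι} {I : Finset (Fin Q.length)}

theorem inner_le_of_mem_brickPolytope {v : V} {c : ℝ}
    (h : ∀ J, S.IsFacet Q J → ⟪S.brickVector Q J, v⟫_ℝ ≤ c) {y : V}
    (hy : y ∈ S.brickPolytope Q) : ⟪y, v⟫_ℝ ≤ c := by
  have hconv : Convex ℝ {y : V | ⟪y, v⟫_ℝ ≤ c} := by
    simp only [real_inner_comm v]
    exact convex_halfSpace_le (innerₛₗ ℝ v).isLinear c
  refine convexHull_min ?_ hconv hy
  rintro _ ⟨J, hJ, rfl⟩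
  exact h J hJ

variable {S}

theorem IsFacet.brickVector_mem (hI : S.IsFacet Q I) :
    S.brickVector Q I ∈ S.brickPolytope Q :=
  subset_convexHull ℝ _ ⟨I, hI, rfl⟩

theorem mem_normalCone_brickVector_iff (v : V) :
    v ∈ normalCone (S.brickPolytope Q) {S.brickVector Q I} ↔
      ∀ J, S.IsFacet Q J → ⟪S.brickVector Q J, v⟫_ℝ ≤ ⟪S.brickVector Q I, v⟫_ℝ := by
  constructor
  · exact fun h J hJ => h _ rfl _ hJ.brickVector_mem
  · rintro h _ rfl y hy
    exact S.inner_le_of_mem_brickPolytope h hy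

variable (S) in
theorem exists_rootConfigSubset (hQ : S.demazure Q = S.longest) (w : S.W) :
    ∃ I, S.IsFacet Q I ∧ S.RootConfigSubset Q I w := by
  obtain ⟨I₀, hI₀⟩ := S.exists_isFacet hQ
  obtain ⟨I, hI, hmax⟩ := hI₀.exists_max_brickVector (S.act w S.weightSum)
  exact ⟨I, hI, hI.rootConfigSubset_of_max S.weightSum_mem w hmax⟩

/-- In a direction inside `w(C)` any maximizing facet satisfies the condition for `w`, so it is `I`
by uniqueness. The boundary follows because normal cones are closed. -/
theorem IsRealizing.act_fundamentalChamber_subset (hreal : S.IsRealizing Q)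
    (hI : S.IsFacet Q I) {w : S.W} (hw : S.RootConfigSubset Q I w) :
    S.act w '' S.fundamentalChamber ⊆
      normalCone (S.brickPolytope Q) {S.brickVector Q I} := by
  rw [← closure_act_openChamber]
  refine closure_minimal ?_ ?_
  · rintro _ ⟨x, hx, rfl⟩
    obtain ⟨M, hM, hmax⟩ := hI.exists_max_brickVector (S.act w x)
    have := hreal.eq_of_rootConfigSubset w hI hM hw (hM.rootConfigSubset_of_max hx w hmax)
    rw [mem_normalCone_brickVector_iff, this]
    exact hmax
  · have : normalCone (S.brickPolytope Q) {S.brickVector Q I} =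
        ⋂ y ∈ S.brickPolytope Q, {v : V | ⟪y, v⟫_ℝ ≤ ⟪S.brickVector Q I, v⟫_ℝ} := by
      ext
      simp [normalCone]
    rw [this]
    exact isClosed_biInter fun y _ => isClosed_le (by fun_prop) (by fun_prop)

/-- As `R(I)` is a basis, some functional takes the value 1 on all of it. -/
theorem IsRealizing.exists_inner_pos (hreal : S.IsRealizing Q) (hI : S.IsFacet Q I) :
    ∃ u : V, ∀ i ∈ I, 0 < ⟪S.rootFn Q I i, u⟫_ℝ := by
  obtain ⟨hli, hspan⟩ := hreal I hI
  let b := Module.Basis.mk hli hspan.ge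
  let f : V →L[ℝ] ℝ := LinearMap.toContinuousLinearMap (b.constr ℝ fun _ => (1 : ℝ))
  refine ⟨(InnerProductSpace.toDual ℝ V).symm f, fun i hi => ?_⟩
  rw [real_inner_comm, InnerProductSpace.toDual_symm_apply]
  have h1 : S.rootFn Q I i = b ⟨i, hi⟩ := by simp [b]
  have h2 : f (b ⟨i, hi⟩) = 1 := b.constr_basis ℝ _ _
  rw [h1, h2]
  exact one_pos

theorem IsRealizing.exists_of_mem_normalCone (hreal : S.IsRealizing Q) (hI : S.IsFacet Q I)
    {v : V} (hv : v ∈ normalCone (S.brickPolytope Q) {S.brickVector Q I}) :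
    ∃ w, S.RootConfigSubset Q I w ∧ v ∈ S.act w '' S.fundamentalChamber := by
  rw [mem_normalCone_brickVector_iff] at hv
  obtain ⟨u, hu⟩ := hreal.exists_inner_pos hI
  have hexp : ∀ (ε : ℝ) (β : V), ⟪β, v + ε • u + ε ^ 2 • S.weightSum⟫_ℝ =
      ⟪β, v⟫_ℝ + ε * ⟪β, u⟫_ℝ + ε ^ 2 * ⟪β, S.weightSum⟫_ℝ := fun ε β => by
    simp only [inner_add_right, inner_smul_right]
  -- `e1` keeps `R(I)` positive at the perturbed point, `e2` moves the point off every root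
  -- hyperplane, and `e3` keeps negative roots negative, so that the chamber reached still contains
  -- `v`.
  have e1 : ∀ᶠ ε in 𝓝[>] (0 : ℝ), ∀ i ∈ I,
      0 < ⟪S.rootFn Q I i, v + ε • u + ε ^ 2 • S.weightSum⟫_ℝ := by
    rw [Filter.eventually_all_finset]
    intro i hi
    simp only [hexp]
    exact eventually_pos_of_nonneg_of_pos _ (hI.inner_rootFn_nonneg hv hi) (hu i hi)
  have e2 : ∀ᶠ ε in 𝓝[>] (0 : ℝ), ∀ p : S.W × ι,
      ⟪S.act p.1 (S.root p.2), v + ε • u + ε ^ 2 • S.weightSum⟫_ℝ ≠ 0 := by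
    rw [Filter.eventually_all]
    intro p
    simp only [hexp]
    exact eventually_ne_zero_of_ne_zero _ _
      (S.inner_ne_zero (S.act_root_mem_roots _ _) S.weightSum_mem)
  have e3 : ∀ᶠ ε in 𝓝[>] (0 : ℝ), ∀ p : S.W × ι, 0 < ⟪-S.act p.1 (S.root p.2), v⟫_ℝ →
      0 < ⟪-S.act p.1 (S.root p.2), v + ε • u + ε ^ 2 • S.weightSum⟫_ℝ := by
    rw [Filter.eventually_all]
    intro p
    simp only [hexp]
    by_cases h : 0 < ⟪-S.act p.1 (S.root p.2), v⟫_ℝ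
    · filter_upwards [eventually_pos_of_pos ⟪-S.act p.1 (S.root p.2), u⟫_ℝ
        ⟪-S.act p.1 (S.root p.2), S.weightSum⟫_ℝ h] with ε hε _ using hε
    · exact Filter.Eventually.of_forall fun ε h' => absurd h' h
  obtain ⟨ε, h1, h2, h3⟩ := (e1.and (e2.and e3)).exists
  set z := v + ε • u + ε ^ 2 • S.weightSum
  obtain ⟨w, hw⟩ := S.exists_mem_act_fundamentalChamber z
  rw [mem_act_fundamentalChamber_iff] at hw
  have hz : z ∈ S.act w '' S.openChamber := by
    rw [mem_act_openChamber_iff]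
    exact fun i => lt_of_le_of_ne (hw i) (h2 (w, i)).symm
  refine ⟨w, ?_, ?_⟩
  · obtain ⟨x, hx, hxz⟩ := hz
    rw [S.rootConfigSubset_iff hx w, hxz]
    exact h1
  · rw [mem_act_fundamentalChamber_iff]
    intro i
    by_contra! hneg
    have h4 := h3 (w, i) (by rw [inner_neg_left]; linarith)
    rw [inner_neg_left] at h4
    linarith [hw i]

theorem IsRealizing.isExposed_brickVector (hreal : S.IsRealizing Q) (hI : S.IsFacet Q I)
    {w : S.W} (hw : S.RootConfigSubset Q I w) :
    IsExposed ℝ (S.brickPolytope Q) {S.brickVector Q I} := by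
  intro _
  set v := S.act w S.weightSum
  set B := S.brickVector Q I
  have hmax := (mem_normalCone_brickVector_iff v).1
    (hreal.act_fundamentalChamber_subset hI hw ⟨_, S.openChamber_subset S.weightSum_mem, rfl⟩)
  -- Convexity of an open half-space with one boundary point added reduces exposedness to the brick
  -- vectors, where a tie would give another maximizer, hence `I` itself.
  have hconv : Convex ℝ {y : V | y = B ∨ ⟪v, y⟫_ℝ < ⟪v, B⟫_ℝ} := by
    rw [convex_iff_forall_pos]
    intro x hx y hy a b ha hb hab
    have key : ⟪v, B⟫_ℝ = a * ⟪v, B⟫_ℝ + b * ⟪v, B⟫_ℝ := by rw [← add_mul, hab, one_mul]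
    rcases hx with rfl | hx
    · rcases hy with rfl | hy
      · exact Or.inl (by rw [← add_smul, hab, one_smul])
      · refine Or.inr ?_
        rw [inner_add_right, inner_smul_right, inner_smul_right]
        linarith [mul_lt_mul_of_pos_left hy hb]
    · refine Or.inr ?_
      rw [inner_add_right, inner_smul_right, inner_smul_right]
      rcases hy with rfl | hy
      · linarith [mul_lt_mul_of_pos_left hx ha]
      · linarith [mul_lt_mul_of_pos_left hx ha, mul_lt_mul_of_pos_left hy hb]
  have hsub : S.brickPolytope Q ⊆ {y : V | y = B ∨ ⟪v, y⟫_ℝ < ⟪v, B⟫_ℝ} := by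
    refine convexHull_min ?_ hconv
    rintro _ ⟨J, hJ, rfl⟩
    rw [Set.mem_ofPred_eq, real_inner_comm, real_inner_comm B]
    refine or_iff_not_imp_right.2 fun hlt => ?_
    have hJmax : ∀ K, S.IsFacet Q K →
        ⟪S.brickVector Q K, v⟫_ℝ ≤ ⟪S.brickVector Q J, v⟫_ℝ :=
      fun K hK => (hmax K hK).trans (not_lt.1 hlt)
    rw [hreal.eq_of_rootConfigSubset w hJ hI
      (hJ.rootConfigSubset_of_max S.weightSum_mem w hJmax) hw]
  refine ⟨innerSL ℝ v, Set.Subset.antisymm ?_ ?_⟩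
  · rintro _ rfl
    refine ⟨hI.brickVector_mem, fun y hy => ?_⟩
    rcases hsub hy with h | h
    · rw [h]
    · exact h.le
  · rintro x ⟨hx, hxmax⟩
    rcases hsub hx with h | h
    · exact h
    · exact absurd (hxmax B hI.brickVector_mem) (not_le.2 h)

variable (S) in
-- This is the smallest face of `w(C)` containing `v`, exposed by minus the sum of the roots `w
-- (α_i)` that vanish at `v`.
theorem face_mem_coxeterFan (w : S.W) {v : V} (hv : v ∈ S.act w '' S.fundamentalChamber) :
    {x ∈ S.act w '' S.fundamentalChamber |
      ∀ i, ⟪S.act w (S.root i), v⟫_ℝ = 0 → ⟪S.act w (S.root i), x⟫_ℝ = 0} ∈ S.coxeterFan := by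
  classical
  refine ⟨S.act w '' S.fundamentalChamber, by rw [chambers_eq]; exact ⟨w, rfl⟩,
    ⟨v, hv, fun i h => h⟩, fun _ => ?_⟩
  set Z := Finset.univ.filter fun i => ⟪S.act w (S.root i), v⟫_ℝ = 0 with hZ
  refine ⟨-∑ i ∈ Z, innerSL ℝ (S.act w (S.root i)), ?_⟩
  have hl : ∀ y, (-∑ i ∈ Z, innerSL ℝ (S.act w (S.root i))) y =
      -∑ i ∈ Z, ⟪S.act w (S.root i), y⟫_ℝ := fun y => by
    simp
  have hnonneg : ∀ y ∈ S.act w '' S.fundamentalChamber,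
      0 ≤ ∑ i ∈ Z, ⟪S.act w (S.root i), y⟫_ℝ := fun y hy =>
    Finset.sum_nonneg fun i _ => (S.mem_act_fundamentalChamber_iff w y).1 hy i
  ext x
  refine and_congr_right fun hx => ?_
  simp only [hl, neg_le_neg_iff]
  constructor
  · intro h y hy
    rw [Finset.sum_eq_zero fun i hi => h i (Finset.mem_filter.1 hi).2]
    exact hnonneg y hy
  · intro h i hi
    have h1 := h v hv
    rw [Finset.sum_eq_zero fun i hi => (Finset.mem_filter.1 hi).2] at h1
    have h2 := le_antisymm h1 (hnonneg x hx)
    rw [Finset.sum_eq_zero_iff_of_nonneg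
      fun i _ => (S.mem_act_fundamentalChamber_iff w x).1 hx i] at h2
    exact h2 i (by simp [hZ, hi])

/-- Since `v` is in the relative interior of the face, `v - ε x` stays in `w(C)` for small `ε`. Both
`x` and `v - ε x` are maximal at `B(I)`; as their combination `v` is also maximal at `p ∈ F`, so is
`x`. -/
theorem IsRealizing.face_subset_normalCone (hreal : S.IsRealizing Q) (hI : S.IsFacet Q I)
    {w : S.W} (hw : S.RootConfigSubset Q I w) {F : Set V} (hF : F ⊆ S.brickPolytope Q) {v : V}
    (hvF : v ∈ normalCone (S.brickPolytope Q) F) (hv : v ∈ S.act w '' S.fundamentalChamber) :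
    {x ∈ S.act w '' S.fundamentalChamber |
      ∀ i, ⟪S.act w (S.root i), v⟫_ℝ = 0 → ⟪S.act w (S.root i), x⟫_ℝ = 0} ⊆
      normalCone (S.brickPolytope Q) F := by
  rintro x ⟨hx, hx0⟩ p hp y hy
  have hsub := hreal.act_fundamentalChamber_subset hI hw
  have hev : ∀ᶠ ε in 𝓝[>] (0 : ℝ), ∀ i, 0 ≤ ⟪S.act w (S.root i), v - ε • x⟫_ℝ := by
    rw [Filter.eventually_all]
    intro i
    simp only [inner_sub_right, inner_smul_right]
    rcases ((S.mem_act_fundamentalChamber_iff w v).1 hv i).eq_or_lt with h | h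
    · simp [← h, hx0 i h.symm]
    · filter_upwards [eventually_pos_of_pos (-⟪S.act w (S.root i), x⟫_ℝ) 0 h] with ε hε
      linarith
  obtain ⟨ε, h1, hε⟩ := (hev.and self_mem_nhdsWithin).exists
  have h2 := hsub ((S.mem_act_fundamentalChamber_iff w _).2 h1) _ rfl p (hF hp)
  have h3 := hvF p hp _ hI.brickVector_mem
  rw [inner_sub_right, inner_sub_right, inner_smul_right, inner_smul_right] at h2
  have h4 : ε * ⟪S.brickVector Q I, x⟫_ℝ ≤ ε * ⟪p, x⟫_ℝ := by linarith
  exact (hsub hx _ rfl y hy).trans (le_of_mul_le_mul_left h4 hε)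

theorem IsRealizing.fanRefines (hreal : S.IsRealizing Q) (hQ : S.demazure Q = S.longest) :
    FanRefines S.coxeterFan (normalFan (S.brickPolytope Q)) := by
  constructor
  · rintro K ⟨D, hD, hne, hK⟩
    rw [chambers_eq] at hD
    obtain ⟨w, rfl⟩ := hD
    obtain ⟨I, hI, hw⟩ := S.exists_rootConfigSubset hQ w
    exact ⟨_, ⟨_, Set.singleton_nonempty _, hreal.isExposed_brickVector hI hw, rfl⟩,
      hK.subset.trans (hreal.act_fundamentalChamber_subset hI hw)⟩
  · rintro L ⟨F, hne, hF, rfl⟩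
    refine ⟨{K ∈ S.coxeterFan | K ⊆ normalCone (S.brickPolytope Q) F}, fun K hK => hK.1,
      Set.Subset.antisymm (fun v hv => ?_) (Set.sUnion_subset fun K hK => hK.2)⟩
    obtain ⟨w, hvw⟩ := S.exists_mem_act_fundamentalChamber v
    obtain ⟨I, hI, hw⟩ := S.exists_rootConfigSubset hQ w
    exact ⟨_, ⟨S.face_mem_coxeterFan w hvw,
      hreal.face_subset_normalCone hI hw hF.subset hv hvw⟩, hvw, fun i h => h⟩

end

end SimpleSystem

end

theorem mainTheorem3 {ι V : Type*} [Fintype ι] [NormedAddCommGroup V] [InnerProductSpace ℝ V]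
    [FiniteDimensional ℝ V] (S : SimpleSystem ι V) (Q : List ι)
    (hQ : S.demazure Q = S.longest) (hreal : S.IsRealizing Q) :
    (∃ κ : S.W → {I : Finset (Fin Q.length) // S.IsFacet Q I},
      (∀ (w : S.W) (I : {I : Finset (Fin Q.length) // S.IsFacet Q I}),
        S.RootConfigSubset Q I.1 w ↔ I = κ w) ∧
      ∀ I : {I : Finset (Fin Q.length) // S.IsFacet Q I},
        normalCone (S.brickPolytope Q) {S.brickVector Q I.1} =
          ⋃ w ∈ {w : S.W | κ w = I}, S.act w '' S.fundamentalChamber) ∧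
    FanRefines S.coxeterFan (normalFan (S.brickPolytope Q)) := by
  refine ⟨?_, hreal.fanRefines hQ⟩
  choose κ hκ hκw using fun w => S.exists_rootConfigSubset hQ w
  have huniq : ∀ (w : S.W) (I : {I : Finset (Fin Q.length) // S.IsFacet Q I}),
      S.RootConfigSubset Q I.1 w ↔ I = ⟨κ w, hκ w⟩ := fun w I =>
    ⟨fun h => Subtype.ext (hreal.eq_of_rootConfigSubset w I.2 (hκ w) h (hκw w)),
      fun h => h ▸ hκw w⟩
  refine ⟨fun w => ⟨κ w, hκ w⟩, huniq, fun I => Set.Subset.antisymm (fun v hv => ?_) ?_⟩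
  · obtain ⟨w, hw, hvw⟩ := hreal.exists_of_mem_normalCone I.2 hv
    exact Set.mem_biUnion ((huniq w I).1 hw).symm hvw
  · refine Set.iUnion₂_subset fun w hw => ?_
    exact hreal.act_fundamentalChamber_subset I.2 ((huniq w I).2 hw.symm)
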